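/- **Model.** Let $2\le K\le n$ be integers and $0<q<p<1$; put $\lambda=p-q$ and $\bar q=q(1-q)$. In the stochastic block model the labels $z_1,\dots,z_n$ are i.i.d. uniform on $\{1,\dots,K\}$ and, given the labels, the edge indicators $Y^*_{ij}$ ($i<j$) are independent Bernoulli variables with parameter $q+\lambda\mathbf 1\{z_i=z_j\}$. Put $Y_{ij}=Y_{ji}=Y^*_{ij}-q$ and $x_{ij}=\mathbf 1\{z_i=z_j\}-1/K$ for $i<j$. **Motif.** Let $k,\alpha,\beta$ be positive integers with $\alpha<\beta$, and put $a=\alpha/\beta$, $r=k+a$, $m=2\beta k$. The blow-up graph with fasteners $G=G_{m,k,a}=(V,E)$ has vertices $v_1,v_2$ and $v_{\omega,t}$ ($1\le\omega\le m$, $1\le t\le k$). Each $v_{\omega,t}$ is joined to every $v_{\omega+1,t'}$ ($\omega+1$ taken cyclically). With $s_\omega=\lfloor a\omega k\rfloor-\lfloor a(\omega-1)k\rfloor$, the fastener nodes are the $v_{\omega,t}$ with $t\le s_\omega$; enumerated in lexicographic order, they are joined alternately to $v_1$ and to $v_2$, starting with $v_1$. **Estimator.** Let $\Lambda=\lceil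 24\log n\rceil$ and $N=\lfloor (n-2)/\Lambda\rfloor+2$. For $i<j$ fix pairwise disjoint sets $J^{(1)}_{ij},\dots,J^{(\Lambda)}_{ij}\subset[n]\setminus\{i,j\}$ of size $N-2$, let $$R^{(\ell)}_{ij}=\sum_{\pi}\ \prod_{(v,v')\in E}Y_{\pi(v)\pi(v')},$$ the sum being over all injections $\pi:V\to\{i,j\}\cup J^{(\ell)}_{ij}$ with $\pi(v_1)=i$ and $\pi(v_2)=j$, let $M_{ij}$ be any median of $R^{(1)}_{ij},\dots,R^{(\Lambda)}_{ij}$ (given by an arbitrary fixed rule), and $$\hat x_{ij}=\mathbf 1\Big\{M_{ij}>\tfrac{(N-2)!}{2\,(N-mk-2)!}\Big(\tfrac{\lambda^{k+a}}{K}\Big)^{mk}\Big\}-\tfrac1K .$$ **Theorem.** There is a numerical constant $c_0>0$ such that, for all positive integers $k,\alpha,\beta$ with $\alpha<\beta$, with $r,m,a$ and $G=G_{m,k,a}$ as above: 1. $G$ is connected, $v_1v_2\notin E$, $|E|=r(|V|-2)$, and for every partition of $V$ into $\ell$ nonempty groups with $v_1,v_2$ in the same group, at least $r(\ell-1)$ edges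 of $G$ join distinct groups. 2. There is a constant $w'>0$, depending only on $k,\alpha,\beta$ (hence only on $r$ when $\alpha/\beta$ is in lowest terms), such that for all $n,K,p,q$ as above with $\bar q=n^{-1/r}$, $n\ge c_0\beta k^2\log n$, $\lambda\le 1-2q$ and $$\lambda\ \ge\ w'\,(\log n)^{1/r}\Big(\frac{\lambda}{K}+\bar q\Big)^{1-\log_n K},$$ for all choices of the sets $J^{(\ell)}_{ij}$ and of the medians, with probability at least $1-1/n$ one has $\hat x_{ij}=x_{ij}$ for all $i<j$, and the connected components of the graph on $[n]$ with edges $\{i<j:\hat x_{ij}=1-1/K\}$ are exactly the nonempty communities $\{i:z_i=c\}$, $c=1,\dots,K$. -/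

import Mathlib

open MeasureTheory ProbabilityTheory
open scoped unitInterval

noncomputable section

/-! ### The blow-up graph with fasteners -/

/-- Vertices of the motif: the distinguished vertices `v₁ = inl 0`, `v₂ = inl 1`, and the cycle
nodes `inr (ω, t)`, `ω < m` the layer and `t < k` the position in it (both counted from `0`). -/
abbrev MotifVertex (m k : ℕ) : Type := Fin 2 ⊕ (Fin m × Fin k)

/-- The distinguished vertex `v₁`. -/
def MotifVertex.v₁ (m k : ℕ) : MotifVertex m k := Sum.inl 0

/-- The distinguished vertex `v₂`. -/
def MotifVertex.v₂ (m k : ℕ) : MotifVertex m k := Sum.inl 1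

/-- The number of fastener nodes in the layer of index `ω` (counted from `0`):
`⌊a (ω + 1) k⌋` minus the total number of fastener nodes in the previous layers. -/
def fastenerCount (k : ℕ) (a : ℚ) (ω : ℕ) : ℕ :=
  ⌊a * ((ω : ℚ) + 1) * k⌋₊ - ∑ i : Fin ω, fastenerCount k a i
termination_by ω
decreasing_by exact i.2

/-- The fastener nodes: in each layer `ω`, the first `fastenerCount k a ω` nodes. -/
def fastenerNodes (m k : ℕ) (a : ℚ) : Finset (Fin m × Fin k) :=
  Finset.univ.filter fun v => v.2.val < fastenerCount k a v.1.val

/-- The number of fastener nodes that strictly precede `v` in the lexicographic order. -/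
def fastenerRank (m k : ℕ) (a : ℚ) (v : Fin m × Fin k) : ℕ :=
  ((fastenerNodes m k a).filter fun w => w.1 < v.1 ∨ (w.1 = v.1 ∧ w.2 < v.2)).card

/-- The generating relation of the edges.  Cycle edges join every node of a layer to every node of
the (cyclically) next layer.  The fastener nodes, enumerated in the lexicographic order, are joined
alternately to `v₁` (even ranks, starting from `0`) and to `v₂` (odd ranks). -/
def blowUpRel (m k : ℕ) (a : ℚ) : MotifVertex m k → MotifVertex m k → Prop
  | Sum.inr u, Sum.inr v => (u.1.val + 1) % m = v.1.val
  | Sum.inl b, Sum.inr v => v ∈ fastenerNodes m k a ∧ fastenerRank m k a v % 2 = b.val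
  | _, Sum.inl _ => False

/-- The blow-up graph with fasteners `G_{m,k,a}`. -/
def blowUpMotif (m k : ℕ) (a : ℚ) : SimpleGraph (MotifVertex m k) :=
  SimpleGraph.fromRel (blowUpRel m k a)

/-! ### Structural property of a motif -/

open Classical in
/-- `G` is connected, `v₁ v₂` is not an edge, `|E| = r (|V| - 2)`, and for every partition of `V`
with `v₁, v₂` in the same part, the number of edges between distinct parts is at least
`r (ℓ - 1)`, where `ℓ` is the number of parts.  A partition is given by a labelling
`c : V → ℕ`, the parts being the nonempty fibres of `c`. -/
structure IsBalancedMotif {V : Type} [Fintype V] (G : SimpleGraph V) (v₁ v₂ : V) (r : ℝ) :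
    Prop where
  connected : G.Connected
  not_adj : ¬ G.Adj v₁ v₂
  card_edges : (G.edgeFinset.card : ℝ) = r * ((Fintype.card V : ℝ) - 2)
  boundary : ∀ c : V → ℕ, c v₁ = c v₂ →
    r * (((Finset.univ.image c).card : ℝ) - 1) ≤
      ((G.edgeFinset.filter fun e => ¬ (e.map c).IsDiag).card : ℝ)

/-! ### The stochastic block model -/

/-- Unordered pairs of distinct nodes of `{1, …, n}`. -/
abbrev NodePair (n : ℕ) : Type := {e : Sym2 (Fin n) // ¬ e.IsDiag}

/-- A community assignment together with an observed graph, `true` marking the edges. -/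
abbrev SBMSample (n K : ℕ) : Type := (Fin n → Fin K) × (NodePair n → Bool)

open Classical in
/-- Given the assignment `z`, the probability `q + (p - q) 1{z_i = z_j}` of the edge `e = {i, j}`
(`(e.map z).IsDiag` says `z_i = z_j`). -/
def edgeProb {n K : ℕ} (p q : ℝ) (z : Fin n → Fin K) (e : NodePair n) : ℝ :=
  q + (p - q) * (if (e.1.map z).IsDiag then 1 else 0)

/-- The conditional law of the observed graph given the community assignment: independent
Bernoulli variables.  (`Set.projIcc` is the identity on `[0, 1]`.) -/
def graphKernel (n K : ℕ) (p q : ℝ) : Kernel (Fin n → Fin K) (NodePair n → Bool) :=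
  Kernel.ofFunOfCountable fun z => Measure.pi fun e =>
    bernoulliMeasure true false (Set.projIcc (0 : ℝ) 1 zero_le_one (edgeProb p q z e))

/-- The law of the community assignment: i.i.d. uniform labels. -/
def labelLaw (n K : ℕ) : Measure (Fin n → Fin K) :=
  Measure.pi fun _ => uniformOn Set.univ

/-- The stochastic block model: the joint law of the assignment and the observed graph. -/
def sbm (n K : ℕ) (p q : ℝ) : Measure (SBMSample n K) :=
  labelLaw n K ⊗ₘ graphKernel n K p q

/-- The membership matrix `x_{ij} = 1{z_i = z_j} - 1/K`. -/
def membership {n K : ℕ} (z : Fin n → Fin K) (i j : Fin n) : ℝ :=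
  (if z i = z j then 1 else 0) - 1 / (K : ℝ)

/-! ### Blow-up counts and the estimator -/

open Classical in
/-- The quasi-centered adjacency matrix `Y_{ij} = Y*_{ij} - q` (`0` on the diagonal). -/
def centeredAdj {n : ℕ} (q : ℝ) (y : NodePair n → Bool) (e : Sym2 (Fin n)) : ℝ :=
  if h : e.IsDiag then 0 else (if y ⟨e, h⟩ then 1 else 0) - q

open Classical in
/-- `∑_π ∏_{(v,v') ∈ E} Y_{π(v),π(v')}`, the sum being over the injections
`π : V → {i, j} ∪ J` such that `π(v₁) = i` and `π(v₂) = j`. -/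
def motifCount {V : Type} [Fintype V] (G : SimpleGraph V) (v₁ v₂ : V) {n : ℕ} (q : ℝ)
    (y : NodePair n → Bool) (i j : Fin n) (J : Finset (Fin n)) : ℝ :=
  ∑ π ∈ (Finset.univ : Finset (V ↪ Fin n)).filter
      (fun π => π v₁ = i ∧ π v₂ = j ∧ ∀ v, π v ∈ insert i (insert j J)),
    ∏ e ∈ G.edgeFinset, centeredAdj q y (e.map π)

/-- The number `Λ = ⌈24 log n⌉` of blocks. -/
def numBlocks (n : ℕ) : ℕ := ⌈24 * Real.log n⌉₊

/-- The common size `⌊(n - 2) / Λ⌋` of the blocks, that is `N - 2`. -/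
def blockSize (n : ℕ) : ℕ := (n - 2) / numBlocks n

/-- `J⁽¹⁾, …, J⁽ᴸ⁾` are pairwise disjoint subsets of `[n] \ {i, j}`, each of size
`blockSize n`. -/
def IsBlockFamily {n : ℕ} (i j : Fin n) (J : Fin (numBlocks n) → Finset (Fin n)) : Prop :=
  (∀ l, i ∉ J l ∧ j ∉ J l ∧ (J l).card = blockSize n) ∧
    ∀ l l', l ≠ l' → Disjoint (J l) (J l')

/-- `M` is a median of the values `u 1, …, u L`. -/
def IsMedian {L : ℕ} (u : Fin L → ℝ) (M : ℝ) : Prop :=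
  L ≤ 2 * Nat.card {l // u l ≤ M} ∧ L ≤ 2 * Nat.card {l // M ≤ u l}

/-- The threshold `(N-2)! / (2 (N-mk-2)!) * (λ^{k+a} / K)^{mk}`. -/
def countThreshold (n K m k : ℕ) (a : ℚ) (lam : ℝ) : ℝ :=
  ((blockSize n).factorial : ℝ) / (2 * ((blockSize n - m * k).factorial : ℝ)) *
    (lam ^ ((k : ℝ) + (a : ℝ)) / (K : ℝ)) ^ (m * k)

open Classical in
/-- The estimator `x̂_{ij} = 1{M_{ij} > threshold} - 1/K` based on the blow-up motif `G_{m,k,a}`,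
where `M_{ij}` is the median, chosen by `med`, of the blow-up counts on the blocks `J`. -/
def blowUpEstimator {n : ℕ} (K m k : ℕ) (a : ℚ) (lam q : ℝ)
    (med : (Fin (numBlocks n) → ℝ) → ℝ) (J : Fin (numBlocks n) → Finset (Fin n))
    (y : NodePair n → Bool) (i j : Fin n) : ℝ :=
  (if countThreshold n K m k a lam <
      med (fun l => motifCount (blowUpMotif m k a) (MotifVertex.v₁ m k) (MotifVertex.v₂ m k)
        q y i j (J l))
    then 1 else 0) - 1 / (K : ℝ)

/-- The graph on `[n]` whose edges are the pairs `i < j` with `xhat i j = 1 - 1/K`. -/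
def estimatedGraph {n : ℕ} (K : ℕ) (xhat : Fin n → Fin n → ℝ) : SimpleGraph (Fin n) :=
  SimpleGraph.fromRel fun i j => i < j ∧ xhat i j = 1 - 1 / (K : ℝ)

/-- The matrix `xhat` recovers the communities of `z`: its entries above the diagonal are those of
the membership matrix, and the connected components of its graph are the communities. -/
def Recovers {n K : ℕ} (xhat : Fin n → Fin n → ℝ) (z : Fin n → Fin K) : Prop :=
  (∀ i j, i < j → xhat i j = membership z i j) ∧
    ∀ i j, (estimatedGraph K xhat).Reachable i j ↔ z i = z j

end

/-! Fix a pair `i < j`, and write D = |V| - 2, Θ = λ^r, B for the block size and q̄ = q(1-q). Given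
the labels, one embedded copy of the motif has mean λ^|E| if all its edges are monochromatic, and 0
otherwise. As G is connected and |E| = rD, fixing the labels of `i` and `j` and averaging over the
others gives mean (Θ/K)^D if the two labels agree and 0 if not. Hence a block count has mean T or 0,
where T is twice the threshold, and what remains is to control its variance.

For two copies with u common free vertices, an edge covered only once must be monochromatic.
Balancedness enters twice. With all vertices outside a set taken as singletons, it bounds the shared
edges by ru, so the union has at least r(2D - u) edges. Applied to the label classes, with those of
`i` and `j` merged, it yields at least r crossing shared edges per extra label. An extra label
therefore costs (q̄/λ)^r, which absorbs its K choices since K(q̄/λ)^r ≤ 1. Relative to (Θ/K)^(2D),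
the averaged pair mean is at most C (K/Θ)^u (`integral_pairMean_le`), and at most 1 or 0 when u = 0.
Summing over pairs, the leading term cancels and the relative squared deviation is O(DK/(ΘB))
(`integral_sqDev_le`). The signal condition gives Θ ≥ W K log n / n, while B is of order n / log n,
so a large W makes this at most 1/60.

Once the labels of `i` and `j` are fixed, different blocks use disjoint node pairs and disjoint
labels. A product bound, `sbm_real_majority_bad_le`, makes a bad majority of blocks have probability
at most 2^(-Λ) ≤ n^(-3). The median is then right, and a union bound over pairs ends the argument.

Balancedness of the motif (`isBalancedMotif_blowUpMotif`) gives each vertex the weight a. A part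
avoiding the roots has forward cyclic boundary plus weight at least k + a; the weight of all
non-root parts is in turn paid by the forward boundary of the root part and the cut fasteners.
Summing over the parts gives the required inequality. -/

/-! ### Independence under product measures -/

section Product

variable {ι κ : Type*} [Fintype ι] [Fintype κ] {X : ι → Type*} [∀ i, MeasurableSpace (X i)]
  [∀ i, Finite (X i)] [∀ i, MeasurableSingletonClass (X i)]

/-- Functions of disjoint sets of coordinates are independent under a product measure. -/
theorem integral_pi_prod_of_dependsOn (μ : ∀ i, Measure (X i)) [∀ i, IsProbabilityMeasure (μ i)]
    (S : κ → Finset ι) (hS : Pairwise fun a b => Disjoint (S a) (S b))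
    (g : κ → (∀ i, X i) → ℝ) (hg : ∀ l, DependsOn (g l) (S l : Set ι)) :
    ∫ x, ∏ l, g l x ∂Measure.pi μ = ∏ l, ∫ x, g l x ∂Measure.pi μ := by
  classical
  have h1 : iIndepFun (fun i (ω : ∀ i, X i) => ω i) (Measure.pi μ) :=
    iIndepFun_pi (X := fun i x => x) fun i => aemeasurable_id
  suffices h : ∀ s : Finset κ,
      ∫ x, ∏ l ∈ s, g l x ∂Measure.pi μ = ∏ l ∈ s, ∫ x, g l x ∂Measure.pi μ from h Finset.univ
  intro s
  induction s using Finset.induction_on with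
  | empty => simp
  | insert a s ha ih =>
    have hd : Disjoint (S a) (s.biUnion S) := by
      rw [Finset.disjoint_biUnion_right]
      exact fun b hb => hS fun hab => ha (hab ▸ hb)
    obtain ⟨F, hF⟩ := dependsOn_iff_exists_comp.1 (hg a)
    have hp : DependsOn (fun x => ∏ l ∈ s, g l x) (s.biUnion S : Set ι) := by
      intro x y hxy
      refine Finset.prod_congr rfl fun l hl => hg l fun i hi => hxy i ?_
      exact Finset.mem_coe.2 (Finset.mem_biUnion.2 ⟨l, hl, hi⟩)
    obtain ⟨G, hG⟩ := dependsOn_iff_exists_comp.1 hp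
    have h2 := h1.indepFun_finset (S a) (s.biUnion S) hd fun i => measurable_pi_apply i
    have h3 : IndepFun (g a) (fun x => ∏ l ∈ s, g l x) (Measure.pi μ) := by
      rw [hF, hG]
      exact h2.comp (measurable_of_countable F) (measurable_of_countable G)
    simp_rw [Finset.prod_insert ha]
    rw [h3.integral_fun_mul_eq_mul_integral (measurable_of_countable _).aestronglyMeasurable
      (measurable_of_countable _).aestronglyMeasurable, ih]

end Product

/-! ### Label averages and conditional edge means -/

section Label

variable {n K : ℕ}

instance [NeZero K] : IsProbabilityMeasure (labelLaw n K) := by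
  unfold labelLaw; infer_instance

instance (p q : ℝ) : IsMarkovKernel (graphKernel n K p q) where
  isProbabilityMeasure z := by
    unfold graphKernel
    change IsProbabilityMeasure (Measure.pi _)
    infer_instance

theorem graphKernel_apply (p q : ℝ) (z : Fin n → Fin K) :
    graphKernel n K p q z = Measure.pi fun e =>
      bernoulliMeasure true false (Set.projIcc (0 : ℝ) 1 zero_le_one (edgeProb p q z e)) := rfl

theorem sbm_real_eq [NeZero K] (p q : ℝ) (s : Set (SBMSample n K)) :
    (sbm n K p q).real s =
      ∫ z, (graphKernel n K p q z).real {y | (z, y) ∈ s} ∂labelLaw n K := by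
  have hs : MeasurableSet s := s.toFinite.measurableSet
  unfold sbm
  rw [measureReal_def, Measure.compProd_apply hs, integral_eq_lintegral_of_nonneg_ae]
  · congr 1
    refine lintegral_congr fun z => ?_
    rw [measureReal_def, ENNReal.ofReal_toReal (measure_ne_top _ _)]
    rfl
  · exact Filter.Eventually.of_forall fun z => measureReal_nonneg
  · exact (measurable_of_countable _).aestronglyMeasurable

theorem integral_labelLaw [NeZero K] (F : (Fin n → Fin K) → ℝ) :
    ∫ z, F z ∂labelLaw n K = ((K : ℝ) ^ n)⁻¹ * ∑ z, F z := by
  rw [integral_fintype Integrable.of_finite, Finset.mul_sum]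
  refine Finset.sum_congr rfl fun z _ => ?_
  have : (labelLaw n K).real {z} = ((K : ℝ) ^ n)⁻¹ := by
    unfold labelLaw
    rw [measureReal_def, Measure.pi_singleton]
    simp [uniformOn_univ]
  rw [this, smul_eq_mul]

/-- Resampling one label does not change the mean. -/
theorem sum_update_eq (i : Fin n) (H : (Fin n → Fin K) → ℝ) :
    ∑ a, ∑ z, H (Function.update z i a) = K * ∑ z, H z := by
  classical
  -- Exchanging the fresh label with the label of `i` is an involution.
  let e : (Fin K × (Fin n → Fin K)) ≃ (Fin K × (Fin n → Fin K)) :=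
    { toFun := fun x => (x.2 i, Function.update x.2 i x.1)
      invFun := fun x => (x.2 i, Function.update x.2 i x.1)
      left_inv := fun x => by simp
      right_inv := fun x => by simp }
  have h := Equiv.sum_comp e fun x => H x.2
  rw [Fintype.sum_prod_type, Fintype.sum_prod_type] at h
  simpa [e] using h

/-- The mean is the average, over the K² values of the two labels, of the means with these labels
imposed. This replaces conditioning on the labels of `i` and `j`. -/
theorem integral_labelLaw_le_of_update [NeZero K] (i j : Fin n) (H : (Fin n → Fin K) → ℝ) (c : ℝ)
    (h : ∀ a b, ∫ z, H (Function.update (Function.update z i a) j b) ∂labelLaw n K ≤ c) :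
    ∫ z, H z ∂labelLaw n K ≤ c := by
  have hK : (0 : ℝ) < K := by exact_mod_cast NeZero.pos K
  have h1 := sum_update_eq j H
  have h2 := fun b => sum_update_eq i fun z => H (Function.update z j b)
  simp_rw [integral_labelLaw] at h ⊢
  have h3 : (K : ℝ) * (K * (((K : ℝ) ^ n)⁻¹ * ∑ z, H z)) =
      ∑ b, ∑ a, ((K : ℝ) ^ n)⁻¹ * ∑ z, H (Function.update (Function.update z i a) j b) := by
    simp_rw [← Finset.mul_sum, h2, ← Finset.mul_sum, h1]
    ring
  have h4 : (K : ℝ) * (K * (((K : ℝ) ^ n)⁻¹ * ∑ z, H z)) ≤ K * (K * c) := by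
    rw [h3]
    calc _ ≤ ∑ _b : Fin K, ∑ _a : Fin K, c :=
          Finset.sum_le_sum fun b _ => Finset.sum_le_sum fun a _ => h a b
      _ = _ := by simp
  exact le_of_mul_le_mul_left (le_of_mul_le_mul_left h4 hK) hK

open Classical in
theorem integral_labelLaw_box [NeZero K] (U : Finset (Fin n)) (S : Finset (Fin K)) :
    ∫ z, (if ∀ v ∈ U, z v ∈ S then (1 : ℝ) else 0) ∂labelLaw n K = ((S.card : ℝ) / K) ^ U.card := by
  have h : ∀ z : Fin n → Fin K, (if ∀ v ∈ U, z v ∈ S then (1 : ℝ) else 0) =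
      ∏ v, if v ∈ U then (if z v ∈ S then (1 : ℝ) else 0) else 1 := by
    intro z
    rw [Finset.prod_ite_mem, Finset.univ_inter, Finset.prod_boole]
    congr
  simp_rw [h]
  unfold labelLaw
  rw [integral_fintype_prod_eq_prod
    (f := fun v x => if v ∈ U then (if x ∈ S then (1 : ℝ) else 0) else 1)]
  have h1 : ∀ v, ∫ x, (if v ∈ U then (if x ∈ S then (1 : ℝ) else 0) else 1)
      ∂(uniformOn Set.univ : Measure (Fin K)) = if v ∈ U then (S.card : ℝ) / K else 1 := by
    intro v
    split_ifs with hv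
    · rw [integral_fintype Integrable.of_finite]
      simp [measureReal_def, uniformOn_univ, div_eq_mul_inv]
    · simp
  simp_rw [h1]
  rw [Finset.prod_ite_mem, Finset.univ_inter, Finset.prod_const]

/-- Conditional mean of a product of functions of the edges. -/
theorem integral_graphKernel_prod {p q : ℝ} (hq : 0 ≤ q) (hqp : q ≤ p) (hp : p ≤ 1)
    (z : Fin n → Fin K) (f : NodePair n → Bool → ℝ) :
    ∫ y, ∏ e, f e (y e) ∂graphKernel n K p q z =
      ∏ e, (edgeProb p q z e * f e true + (1 - edgeProb p q z e) * f e false) := by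
  rw [graphKernel_apply, integral_fintype_prod_eq_prod]
  refine Finset.prod_congr rfl fun e _ => ?_
  have he : edgeProb p q z e ∈ Set.Icc (0 : ℝ) 1 := by
    unfold edgeProb
    split_ifs <;> constructor <;> linarith
  rw [integral_bernoulliMeasure, Set.projIcc_of_mem _ he]
  simp

end Label

/-! ### Embedded motifs, their mixed moments, and forms of balancedness -/

section Motif

open Classical

variable {V : Type} [Fintype V] {G : SimpleGraph V} {v₁ v₂ : V} {r : ℝ} {n K : ℕ}

/-- The node pairs onto which `π` maps the edges of `G`. -/
noncomputable def edgeImage (G : SimpleGraph V) (π : V ↪ Fin n) : Finset (NodePair n) :=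
  Finset.univ.filter fun e => ∃ e' ∈ G.edgeFinset, e'.map π = e.1

theorem map_not_isDiag {e : Sym2 V} (he : e ∈ G.edgeFinset) (π : V ↪ Fin n) :
    ¬ (e.map π).IsDiag := by
  rw [Sym2.isDiag_map π.injective]
  exact G.not_isDiag_of_mem_edgeSet (SimpleGraph.mem_edgeFinset.1 he)

theorem prod_edgeFinset_eq (π : V ↪ Fin n) (f : NodePair n → ℝ) (g : Sym2 (Fin n) → ℝ)
    (hfg : ∀ e : NodePair n, g e.1 = f e) :
    ∏ e ∈ G.edgeFinset, g (e.map π) = ∏ e ∈ edgeImage G π, f e := by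
  refine Finset.prod_bij (fun e he => ⟨e.map π, map_not_isDiag he π⟩) ?_ ?_ ?_ ?_
  · intro e he
    simp only [edgeImage, Finset.mem_filter, Finset.mem_univ, true_and]
    exact ⟨e, he, rfl⟩
  · intro e he e' he' h
    exact Sym2.map.injective π.injective (congrArg Subtype.val h)
  · intro e he
    simp only [edgeImage, Finset.mem_filter, Finset.mem_univ, true_and] at he
    obtain ⟨e', he', h⟩ := he
    exact ⟨e', he', Subtype.ext h⟩
  · intro e he
    exact hfg ⟨e.map π, map_not_isDiag he π⟩

theorem card_edgeImage_filter (π : V ↪ Fin n) (P : Sym2 (Fin n) → Prop) :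
    ((edgeImage G π).filter fun e => P e.1).card =
      (G.edgeFinset.filter fun e => P (e.map π)).card := by
  symm
  refine Finset.card_bij
    (fun e he => ⟨e.map π, map_not_isDiag (Finset.mem_filter.1 he).1 π⟩) ?_ ?_ ?_
  · intro e he
    simp only [edgeImage, Finset.mem_filter, Finset.mem_univ, true_and] at he ⊢
    exact ⟨⟨e, he.1, rfl⟩, he.2⟩
  · intro e he e' he' h
    exact Sym2.map.injective π.injective (congrArg Subtype.val h)
  · intro e he
    simp only [edgeImage, Finset.mem_filter, Finset.mem_univ, true_and] at he
    obtain ⟨⟨e', he', h⟩, h2⟩ := he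
    exact ⟨e', Finset.mem_filter.2 ⟨he', h ▸ h2⟩, Subtype.ext h⟩

theorem card_edgeImage (π : V ↪ Fin n) : (edgeImage G π).card = G.edgeFinset.card := by
  have := card_edgeImage_filter (G := G) π fun _ => True
  simpa using this

/-- The indicator that the two ends of `e` have the same label. -/
noncomputable def sameLabel (z : Fin n → Fin K) (e : NodePair n) : ℝ :=
  if (e.1.map z).IsDiag then 1 else 0

/-- The conditional mean of `∏ e ∈ A, Y e * ∏ e ∈ B, Y e` given the labels. -/
noncomputable def pairMean (p q : ℝ) (z : Fin n → Fin K) (A B : Finset (NodePair n)) : ℝ :=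
  (∏ e ∈ A ∩ B, (q * (1 - q) + (p - q) * (1 - 2 * q) * sameLabel z e)) *
    ∏ e ∈ symmDiff A B, (p - q) * sameLabel z e

theorem integral_graphKernel_pair {p q : ℝ} (hq : 0 ≤ q) (hqp : q ≤ p) (hp : p ≤ 1)
    (z : Fin n → Fin K) (A B : Finset (NodePair n)) :
    ∫ y, (∏ e ∈ A, ((if y e then (1 : ℝ) else 0) - q)) *
        ∏ e ∈ B, ((if y e then (1 : ℝ) else 0) - q) ∂graphKernel n K p q z =
      pairMean p q z A B := by
  have h := integral_graphKernel_prod hq hqp hp z fun e b =>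
    (if e ∈ A then ((if b then (1 : ℝ) else 0) - q) else 1) *
      (if e ∈ B then ((if b then (1 : ℝ) else 0) - q) else 1)
  simp_rw [Finset.prod_mul_distrib, Finset.prod_ite_mem, Finset.univ_inter] at h
  rw [h, pairMean, ← Finset.univ_inter (A ∩ B), ← Finset.univ_inter (symmDiff A B),
    ← Finset.prod_ite_mem, ← Finset.prod_ite_mem, ← Finset.prod_mul_distrib]
  refine Finset.prod_congr rfl fun e _ => ?_
  simp only [Finset.mem_inter, Finset.mem_symmDiff]
  have hE : edgeProb p q z e = q + (p - q) * sameLabel z e := rfl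
  -- With s = `sameLabel z e`, one factor has mean λs and its square has mean q(1-q) + λ(1-2q)s.
  by_cases hA : e ∈ A <;> by_cases hB : e ∈ B <;> 
    simp only [hA, hB, hE, if_true, if_false, and_true, and_false, or_false,
      false_or, not_true_eq_false, not_false_eq_true, or_self, Bool.false_eq_true] <;> ring

theorem pairMean_empty (p q : ℝ) (z : Fin n → Fin K) (A : Finset (NodePair n)) :
    pairMean p q z A ∅ = ∏ e ∈ A, (p - q) * sameLabel z e := by
  rw [pairMean, Finset.inter_empty, Finset.prod_empty, one_mul, ← Finset.bot_eq_empty,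
    symmDiff_bot]

/-! ### Consequences of balancedness -/


namespace IsBalancedMotif

/-- Take `S` as one part and every other vertex as a singleton: at least r(|V| - |S|) of the r(|V| -
2) edges cross. -/
theorem inner_card_le (hG : IsBalancedMotif G v₁ v₂ r) (S : Finset V) (h₁ : v₁ ∈ S)
    (h₂ : v₂ ∈ S) :
    ((G.edgeFinset.filter fun e => ∀ v ∈ e, v ∈ S).card : ℝ) ≤ r * ((S.card : ℝ) - 2) := by
  let c : V → ℕ := fun v => if v ∈ S then 0 else (Fintype.equivFin V v : ℕ) + 1
  have hb := hG.boundary c (by simp [c, h₁, h₂])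
  have hinj : Set.InjOn c (Sᶜ : Finset V) := by
    intro v hv w hw h
    simp only [Finset.coe_compl, Set.mem_compl_iff, Finset.mem_coe] at hv hw
    simp only [c, hv, hw, if_false, add_left_inj] at h
    exact (Fintype.equivFin V).injective (Fin.ext h)
  have himg : Finset.univ.image c = insert 0 (Sᶜ.image c) := by
    ext a
    simp only [Finset.mem_image, Finset.mem_univ, true_and, Finset.mem_insert, Finset.mem_compl]
    constructor
    · rintro ⟨v, rfl⟩
      by_cases hv : v ∈ S
      · left; simp [c, hv]
      · right; exact ⟨v, hv, rfl⟩
    · rintro (rfl | ⟨v, -, rfl⟩)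
      · exact ⟨v₁, by simp [c, h₁]⟩
      · exact ⟨v, rfl⟩
  have hcard : (Finset.univ.image c).card = 1 + (Fintype.card V - S.card) := by
    rw [himg, Finset.card_insert_of_notMem, Finset.card_image_of_injOn hinj, Finset.card_compl,
      add_comm]
    simp only [Finset.mem_image, Finset.mem_compl, not_exists, not_and]
    intro v hv
    simp [c, hv]
  have hsplit := Finset.card_filter_add_card_filter_not (s := G.edgeFinset)
    (fun e => (e.map c).IsDiag)
  have hle : (G.edgeFinset.filter fun e => ∀ v ∈ e, v ∈ S).card ≤
      (G.edgeFinset.filter fun e => (e.map c).IsDiag).card := by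
    refine Finset.card_le_card fun e he => ?_
    simp only [Finset.mem_filter] at he ⊢
    refine ⟨he.1, ?_⟩
    induction e using Sym2.ind with
    | h x y =>
      have hx := he.2 x (by simp)
      have hy := he.2 y (by simp)
      simp [c, hx, hy]
  have hE := hG.card_edges
  rw [hcard, Nat.cast_add, Nat.cast_sub S.card_le_univ] at hb
  have hs : ((G.edgeFinset.filter fun e => (e.map c).IsDiag).card : ℝ) +
      ((G.edgeFinset.filter fun e => ¬ (e.map c).IsDiag).card : ℝ) = G.edgeFinset.card := by
    exact_mod_cast hsplit
  have hl : ((G.edgeFinset.filter fun e => ∀ v ∈ e, v ∈ S).card : ℝ) ≤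
      (G.edgeFinset.filter fun e => (e.map c).IsDiag).card := by exact_mod_cast hle
  push_cast at hb
  linarith

/-- Merging the classes of `v₁` and `v₂` makes the boundary inequality applicable and creates no new
crossing edge. -/
theorem le_crossing_card (hG : IsBalancedMotif G v₁ v₂ r) (L : V → Fin K) :
    r * (((Finset.univ.image L) \ {L v₁, L v₂}).card : ℝ) ≤
      ((G.edgeFinset.filter fun e => ¬ (e.map L).IsDiag).card : ℝ) := by
  let d : Fin K → ℕ := fun l => if l = L v₁ ∨ l = L v₂ then 0 else (l : ℕ) + 1
  have hb := hG.boundary (d ∘ L) (by simp [d])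
  have hinj : Set.InjOn d ((Finset.univ.image L) \ {L v₁, L v₂} : Finset (Fin K)) := by
    intro a ha b hb h
    simp only [Finset.coe_sdiff, Set.mem_sdiff, Finset.coe_insert, Finset.coe_singleton,
      Set.mem_insert_iff, Set.mem_singleton_iff] at ha hb
    simp only [d, ha.2, hb.2, if_false, add_left_inj] at h
    exact Fin.ext h
  have himg : Finset.univ.image (d ∘ L) =
      insert 0 (((Finset.univ.image L) \ {L v₁, L v₂}).image d) := by
    ext a
    simp only [Finset.mem_image, Finset.mem_univ, true_and, Finset.mem_insert, Finset.mem_sdiff,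
      Finset.mem_singleton, Function.comp]
    constructor
    · rintro ⟨v, rfl⟩
      by_cases hv : L v = L v₁ ∨ L v = L v₂
      · left; simp [d, hv]
      · right; exact ⟨L v, ⟨⟨v, rfl⟩, hv⟩, rfl⟩
    · rintro (rfl | ⟨_, ⟨⟨v, rfl⟩, -⟩, rfl⟩)
      · exact ⟨v₁, by simp [d]⟩
      · exact ⟨v, rfl⟩
  have hcard : (Finset.univ.image (d ∘ L)).card =
      ((Finset.univ.image L) \ {L v₁, L v₂}).card + 1 := by
    rw [himg, Finset.card_insert_of_notMem, Finset.card_image_of_injOn hinj]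
    simp only [Finset.mem_image, Finset.mem_sdiff, Finset.mem_insert, Finset.mem_singleton,
      not_exists, not_and]
    intro a ha
    simp [d, ha.2]
  rw [hcard] at hb
  push_cast at hb
  rw [add_sub_cancel_right] at hb
  refine hb.trans ?_
  norm_cast
  refine Finset.card_le_card fun e he => ?_
  simp only [Finset.mem_filter] at he ⊢
  refine ⟨he.1, fun h => he.2 ?_⟩
  induction e using Sym2.ind with
  | h x y =>
    simp only [Sym2.map_mk, Sym2.mk_isDiag_iff, Function.comp] at h ⊢
    rw [h]

theorem exists_boundary_edge (hG : IsBalancedMotif G v₁ v₂ r) (S : Set V) {x y : V}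
    (hx : x ∈ S) (hy : y ∉ S) : ∃ a b, G.Adj a b ∧ a ∈ S ∧ b ∉ S := by
  obtain ⟨w⟩ := hG.connected.preconnected x y
  obtain ⟨d, -, h1, h2⟩ := w.exists_boundary_dart S hx hy
  exact ⟨d.fst, d.snd, d.adj, h1, h2⟩

end IsBalancedMotif

end Motif

/-! ### Pointwise bound on the mixed moment of two copies -/

section PairBound

open Classical

variable {V : Type} [Fintype V] {G : SimpleGraph V} {v₁ v₂ : V} {r : ℝ} {n K : ℕ}

theorem sameLabel_eq_zero_or_one (z : Fin n → Fin K) (e : NodePair n) :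
    sameLabel z e = 0 ∨ sameLabel z e = 1 := by
  unfold sameLabel
  split_ifs <;> simp

theorem pairMean_eq_zero {p q : ℝ} (z : Fin n → Fin K) {A B : Finset (NodePair n)}
    {e : NodePair n} (he : e ∈ symmDiff A B) (h : ¬ (e.1.map z).IsDiag) :
    pairMean p q z A B = 0 := by
  rw [pairMean, Finset.prod_eq_zero he (by simp [sameLabel, h]), mul_zero]

/-- Since q̄ ≤ λ, a monochromatic shared edge contributes at most 2λ; a crossing one contributes q̄,
at most 2λ times q̄/λ. -/
theorem pairMean_le {p q : ℝ} (hq : 0 < q) (hqp : q < p) (hp : p < 1) (hlam : p - q ≤ 1 - 2 * q)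
    (hql : q * (1 - q) ≤ p - q) (z : Fin n → Fin K) (A B : Finset (NodePair n)) :
    pairMean p q z A B ≤ 2 ^ (A ∩ B).card * (p - q) ^ (A ∪ B).card *
      (q * (1 - q) / (p - q)) ^ ((A ∩ B).filter fun e => ¬ (e.1.map z).IsDiag).card := by
  have hl : 0 < p - q := by linarith
  have hqb : 0 < q * (1 - q) := mul_pos hq (by linarith)
  have h1 : ∏ e ∈ symmDiff A B, (p - q) * sameLabel z e ≤ (p - q) ^ (symmDiff A B).card := by
    rw [← Finset.prod_const]
    refine Finset.prod_le_prod (fun e _ => ?_) fun e _ => ?_ <;>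
      rcases sameLabel_eq_zero_or_one z e with h | h <;> rw [h] <;> simp [hl.le]
  have h2 : ∏ e ∈ A ∩ B, (q * (1 - q) + (p - q) * (1 - 2 * q) * sameLabel z e) ≤
      ∏ e ∈ A ∩ B, (2 * (p - q)) *
        (if ¬ (e.1.map z).IsDiag then q * (1 - q) / (p - q) else 1) := by
    refine Finset.prod_le_prod (fun e _ => ?_) fun e _ => ?_
    · rcases sameLabel_eq_zero_or_one z e with h | h <;> rw [h]
      · simpa using hqb.le
      · have : 0 < (p - q) * (1 - 2 * q) := mul_pos hl (by linarith)
        linarith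
    · unfold sameLabel
      by_cases hd : (e.1.map z).IsDiag
      · rw [if_pos hd, if_neg (not_not.2 hd)]
        have : (p - q) * (1 - 2 * q) ≤ p - q := by nlinarith
        linarith
      · rw [if_neg hd, if_pos hd]
        have : 2 * (p - q) * (q * (1 - q) / (p - q)) = 2 * (q * (1 - q)) := by field_simp
        rw [this]; linarith
  rw [Finset.prod_mul_distrib, Finset.prod_const, Finset.prod_ite, Finset.prod_const,
    Finset.prod_const_one, mul_one] at h2
  have h3 : 0 ≤ ∏ e ∈ symmDiff A B, (p - q) * sameLabel z e := by
    refine Finset.prod_nonneg fun e _ => ?_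
    rcases sameLabel_eq_zero_or_one z e with h | h <;> rw [h] <;> simp [hl.le]
  have hcard : (A ∪ B).card = (A ∩ B).card + (symmDiff A B).card := by
    rw [← Finset.card_union_of_disjoint]
    · congr 1
      ext e; simp only [Finset.mem_union, Finset.mem_inter, Finset.mem_symmDiff]; tauto
    · rw [Finset.disjoint_left]
      intro e; simp only [Finset.mem_inter, Finset.mem_symmDiff]; tauto
  calc pairMean p q z A B ≤ _ := mul_le_mul h2 h1 h3 (by positivity)
    _ = _ := by rw [hcard, mul_pow, pow_add]; ring

/-- The image of the vertices other than `v₁`, `v₂`. -/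
noncomputable def freeImage (v₁ v₂ : V) (π : V ↪ Fin n) : Finset (Fin n) :=
  (Finset.univ \ {v₁, v₂}).map π

/-- The number of vertices other than `v₁`, `v₂` that `π'` maps into the free image of `π`. -/
noncomputable def overlap (v₁ v₂ : V) (π π' : V ↪ Fin n) : ℕ :=
  ((Finset.univ \ {v₁, v₂}).filter fun v => π' v ∈ freeImage v₁ v₂ π).card

theorem card_sdiff_pair (h : v₁ ≠ v₂) :
    (Finset.univ \ {v₁, v₂} : Finset V).card = Fintype.card V - 2 := by
  rw [Finset.card_sdiff_of_subset (Finset.subset_univ _), Finset.card_pair h, Finset.card_univ]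

theorem card_freeImage (h : v₁ ≠ v₂) (π : V ↪ Fin n) :
    (freeImage v₁ v₂ π).card = Fintype.card V - 2 := by
  rw [freeImage, Finset.card_map, card_sdiff_pair h]

theorem overlap_le (h : v₁ ≠ v₂) (π π' : V ↪ Fin n) :
    overlap v₁ v₂ π π' ≤ Fintype.card V - 2 := by
  rw [← card_sdiff_pair h]
  exact Finset.card_filter_le _ _

theorem card_freeImage_union (h : v₁ ≠ v₂) (π π' : V ↪ Fin n) :
    (freeImage v₁ v₂ π ∪ freeImage v₁ v₂ π').card =
      2 * (Fintype.card V - 2) - overlap v₁ v₂ π π' := by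
  have h1 : freeImage v₁ v₂ π' ∩ freeImage v₁ v₂ π =
      ((Finset.univ \ {v₁, v₂}).filter fun v => π' v ∈ freeImage v₁ v₂ π).map π' := by
    ext a
    simp only [Finset.mem_inter, Finset.mem_map, Finset.mem_filter]
    constructor
    · rintro ⟨ha, hb⟩
      obtain ⟨v, hv, rfl⟩ := Finset.mem_map.1 ha
      exact ⟨v, ⟨hv, hb⟩, rfl⟩
    · rintro ⟨v, ⟨hv, hb⟩, rfl⟩
      exact ⟨Finset.mem_map_of_mem _ hv, hb⟩
  have h2 := Finset.card_union_add_card_inter (freeImage v₁ v₂ π) (freeImage v₁ v₂ π')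
  rw [Finset.inter_comm, h1, Finset.card_map, card_freeImage h, card_freeImage h] at h2
  unfold overlap
  omega

/-- A shared edge, read through `π'`, lies inside the set of vertices that `π'` sends into the range
of `π`. This set contains both roots and at most `overlap` other vertices, so `inner_card_le`
applies. -/
theorem IsBalancedMotif.card_edgeImage_inter_le (hG : IsBalancedMotif G v₁ v₂ r) (hr : 0 ≤ r)
    {π π' : V ↪ Fin n} (h₁ : π v₁ = π' v₁) (h₂ : π v₂ = π' v₂) :
    ((edgeImage G π ∩ edgeImage G π').card : ℝ) ≤ r * overlap v₁ v₂ π π' := by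
  let S : Finset V := Finset.univ.filter fun v => π' v ∈ Finset.univ.map π
  have hS1 : v₁ ∈ S := by simp [S, ← h₁]
  have hS2 : v₂ ∈ S := by simp [S, ← h₂]
  have hle : (edgeImage G π ∩ edgeImage G π').card ≤
      (G.edgeFinset.filter fun e => ∀ v ∈ e, v ∈ S).card := by
    have h := card_edgeImage_filter (G := G) π' fun e => ∀ v ∈ e, v ∈ Finset.univ.map π
    have h' : (G.edgeFinset.filter fun e => ∀ v ∈ e, v ∈ S) =
        G.edgeFinset.filter fun e => ∀ v ∈ e.map π', v ∈ Finset.univ.map π := by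
      refine Finset.filter_congr fun e _ => ?_
      simp [S, Sym2.mem_map]
    rw [h']
    have hsub : edgeImage G π ∩ edgeImage G π' ⊆ (edgeImage G π').filter
        fun e => ∀ v ∈ e.1, v ∈ Finset.univ.map π := by
      intro e he
      rw [Finset.mem_inter] at he
      refine Finset.mem_filter.2 ⟨he.2, fun v hv => ?_⟩
      simp only [edgeImage, Finset.mem_filter, Finset.mem_univ, true_and] at he
      obtain ⟨⟨e', -, h'⟩, -⟩ := he
      rw [← h', Sym2.mem_map] at hv
      obtain ⟨w, -, rfl⟩ := hv
      simp
    exact (Finset.card_le_card hsub).trans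
      (le_of_eq (Eq.trans (by congr!) (h.trans (by congr!))))
  have hcard : S.card ≤ overlap v₁ v₂ π π' + 2 := by
    have : S ⊆ ((Finset.univ \ {v₁, v₂}).filter fun v => π' v ∈ freeImage v₁ v₂ π) ∪
        {v₁, v₂} := by
      intro v hv
      by_cases hv' : v ∈ ({v₁, v₂} : Finset V)
      · exact Finset.mem_union_right _ hv'
      refine Finset.mem_union_left _ (Finset.mem_filter.2 ⟨by simpa using hv', ?_⟩)
      simp only [S, Finset.mem_filter, Finset.mem_map, Finset.mem_univ, true_and] at hv
      obtain ⟨w, hw⟩ := hv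
      rw [← hw]
      refine Finset.mem_map_of_mem _ ?_
      simp only [Finset.mem_sdiff, Finset.mem_univ, true_and, Finset.mem_insert,
        Finset.mem_singleton] at hv' ⊢
      rintro (rfl | rfl)
      · exact hv' (Or.inl (π'.injective (hw.symm.trans h₁)))
      · exact hv' (Or.inr (π'.injective (hw.symm.trans h₂)))
    refine (Finset.card_le_card this).trans ((Finset.card_union_le _ _).trans ?_)
    exact Nat.add_le_add_left Finset.card_le_two _
  calc ((edgeImage G π ∩ edgeImage G π').card : ℝ)
      ≤ ((G.edgeFinset.filter fun e => ∀ v ∈ e, v ∈ S).card : ℝ) := by exact_mod_cast hle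
    _ ≤ r * ((S.card : ℝ) - 2) := hG.inner_card_le S hS1 hS2
    _ ≤ _ := by
      refine mul_le_mul_of_nonneg_left ?_ hr
      have : (S.card : ℝ) ≤ overlap v₁ v₂ π π' + 2 := by exact_mod_cast hcard
      linarith

/-- If the edges covered once have ends with equal labels, the labels seen by `π'` are seen by
`π`. -/
theorem IsBalancedMotif.exists_label_eq (hG : IsBalancedMotif G v₁ v₂ r) {π π' : V ↪ Fin n}
    (h₁ : π v₁ = π' v₁) (z : Fin n → Fin K)
    (hz : ∀ e ∈ symmDiff (edgeImage G π) (edgeImage G π'), (e.1.map z).IsDiag) (v : V) :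
    ∃ w, z (π' v) = z (π w) := by
  by_contra! hcon
  -- An edge of the second copy leaving the label class of `v` is not monochromatic, hence is
  -- shared; its endpoint in the class then lies in the range of `π`.
  obtain ⟨a, b, hab, ha, hb⟩ := hG.exists_boundary_edge {x | z (π' x) = z (π' v)} (x := v)
    (y := v₁) rfl (fun h => hcon v₁ (by rw [h₁]; exact h.symm))
  have he : s(a, b) ∈ G.edgeFinset := by simpa using hab
  let e : NodePair n := ⟨s(a, b).map π', map_not_isDiag he π'⟩
  have heB : e ∈ edgeImage G π' := by
    simp only [edgeImage, Finset.mem_filter, Finset.mem_univ, true_and]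
    exact ⟨s(a, b), he, rfl⟩
  have hne : ¬ (e.1.map z).IsDiag := by
    simp only [e, Sym2.map_mk, Sym2.mk_isDiag_iff]
    intro h
    exact hb (h.symm.trans ha)
  have heA : e ∈ edgeImage G π := by
    by_contra heA
    exact hne (hz e (Finset.mem_symmDiff.2 (Or.inr ⟨heB, heA⟩)))
  simp only [edgeImage, Finset.mem_filter, Finset.mem_univ, true_and] at heA
  obtain ⟨e', -, h'⟩ := heA
  have hmem : π' a ∈ e'.map π := by rw [h']; simp [e]
  obtain ⟨w, -, hw⟩ := Sym2.mem_map.1 hmem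
  exact hcon w (by rw [hw]; exact ha.symm)

/-- The sum of `x ^ |S|` over the sets `S` of at most `D` labels that contain, together with the
labels of `i` and `j`, the labels of all nodes in `U`. -/
noncomputable def labelSum (x : ℝ) (D : ℕ) (i j : Fin n) (U : Finset (Fin n))
    (z : Fin n → Fin K) : ℝ :=
  ∑ S ∈ (Finset.univ : Finset (Fin K)).powerset,
    if S.card ≤ D then x ^ S.card *
      (if ∀ v ∈ U, z v ∈ insert (z i) (insert (z j) S) then 1 else 0) else 0

theorem pow_le_labelSum {x : ℝ} (hx : 0 ≤ x) {D : ℕ} (i j : Fin n) (U : Finset (Fin n))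
    (z : Fin n → Fin K) (S : Finset (Fin K)) (hS : S.card ≤ D)
    (hU : ∀ v ∈ U, z v ∈ insert (z i) (insert (z j) S)) :
    x ^ S.card ≤ labelSum x D i j U z := by
  unfold labelSum
  refine le_trans (le_of_eq ?_) (Finset.single_le_sum (f := fun S : Finset (Fin K) =>
    if S.card ≤ D then x ^ S.card *
      (if ∀ v ∈ U, z v ∈ insert (z i) (insert (z j) S) then (1 : ℝ) else 0) else 0)
    (fun S _ => ?_) (Finset.mem_powerset.2 (Finset.subset_univ S)))
  · simp only [hS, if_true]
    rw [if_pos hU, mul_one]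
  · split_ifs <;> positivity

theorem labelSum_nonneg {x : ℝ} (hx : 0 ≤ x) {D : ℕ} (i j : Fin n) (U : Finset (Fin n))
    (z : Fin n → Fin K) : 0 ≤ labelSum x D i j U z := by
  unfold labelSum
  refine Finset.sum_nonneg fun S _ => ?_
  split_ifs <;> positivity

theorem IsBalancedMotif.pairMean_le_labelSum (hG : IsBalancedMotif G v₁ v₂ r) (hr : 0 ≤ r)
    (hv : v₁ ≠ v₂) {p q : ℝ} (hq : 0 < q) (hqp : q < p) (hp : p < 1)
    (hlam : p - q ≤ 1 - 2 * q) (hql : q * (1 - q) ≤ p - q) (z : Fin n → Fin K)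
    {π π' : V ↪ Fin n} {i j : Fin n} (hπ₁ : π v₁ = i) (hπ₂ : π v₂ = j) (hπ'₁ : π' v₁ = i)
    (hπ'₂ : π' v₂ = j) :
    pairMean p q z (edgeImage G π) (edgeImage G π') ≤
      2 ^ G.edgeFinset.card *
        ((p - q) ^ r) ^ (2 * (Fintype.card V - 2) - overlap v₁ v₂ π π') *
        labelSum ((q * (1 - q) / (p - q)) ^ r) (Fintype.card V - 2) i j
          (freeImage v₁ v₂ π ∪ freeImage v₁ v₂ π') z := by
  have hl : 0 < p - q := by linarith
  have hqb : 0 < q * (1 - q) := mul_pos hq (by linarith)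
  have hρ : 0 < q * (1 - q) / (p - q) := div_pos hqb hl
  have hρ1 : q * (1 - q) / (p - q) ≤ 1 := (div_le_one hl).2 hql
  have hx := Real.rpow_nonneg hρ.le r
  by_cases hz : ∀ e ∈ symmDiff (edgeImage G π) (edgeImage G π'), (e.1.map z).IsDiag
  swap
  · push Not at hz
    obtain ⟨e, he, h⟩ := hz
    rw [pairMean_eq_zero z he h]
    have := labelSum_nonneg hx (D := Fintype.card V - 2) i j
      (freeImage v₁ v₂ π ∪ freeImage v₁ v₂ π') z
    positivity
  set A := edgeImage G π with hA
  set B := edgeImage G π' with hB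
  set u := overlap v₁ v₂ π π' with hu
  set D := Fintype.card V - 2 with hD
  have huD : u ≤ D := overlap_le hv π π'
  have hV2 : 2 ≤ Fintype.card V := by
    have := Finset.card_le_univ ({v₁, v₂} : Finset V)
    rwa [Finset.card_pair hv] at this
  -- The extra labels of the first copy. Together with those of `i` and `j` they also cover the
  -- second copy, by `exists_label_eq`.
  set S := Finset.univ.image (z ∘ π) \ {z i, z j} with hS
  have hcross : r * (S.card : ℝ) ≤ ((A ∩ B).filter fun e => ¬ (e.1.map z).IsDiag).card := by
    have h := hG.le_crossing_card (z ∘ π)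
    rw [Function.comp_apply, Function.comp_apply, hπ₁, hπ₂] at h
    refine h.trans ?_
    have h' := card_edgeImage_filter (G := G) π fun e => ¬ (e.map z).IsDiag
    simp only [Sym2.map_map] at h'
    rw [← h']
    norm_cast
    refine Finset.card_le_card fun e he => ?_
    simp only [Finset.mem_filter, Finset.mem_inter] at he ⊢
    -- A crossing edge covered once would contradict `hz`, so every crossing edge is shared.
    refine ⟨⟨he.1, ?_⟩, he.2⟩
    by_contra hne
    exact he.2 (hz e (Finset.mem_symmDiff.2 (Or.inl ⟨he.1, hne⟩)))
  have hSD : S.card ≤ D := by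
    have : S ⊆ (Finset.univ \ {v₁, v₂}).image (z ∘ π) := by
      intro a ha
      simp only [hS, Finset.mem_sdiff, Finset.mem_image, Finset.mem_univ, true_and,
        Finset.mem_insert, Finset.mem_singleton, Function.comp] at ha ⊢
      obtain ⟨⟨v, rfl⟩, hne⟩ := ha
      refine ⟨v, ?_, rfl⟩
      rintro (rfl | rfl)
      · exact hne (Or.inl (by rw [hπ₁]))
      · exact hne (Or.inr (by rw [hπ₂]))
    refine (Finset.card_le_card this).trans (Finset.card_image_le.trans ?_)
    rw [card_sdiff_pair hv]
  have hcov : ∀ w, z (π w) ∈ insert (z i) (insert (z j) S) := by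
    intro w
    simp only [hS, Finset.mem_insert, Finset.mem_sdiff, Finset.mem_image, Finset.mem_univ,
      true_and, Finset.mem_singleton, Function.comp]
    by_cases h : z (π w) = z i
    · exact Or.inl h
    · by_cases h' : z (π w) = z j
      · exact Or.inr (Or.inl h')
      · exact Or.inr (Or.inr ⟨⟨w, rfl⟩, by tauto⟩)
  have hU : ∀ v ∈ freeImage v₁ v₂ π ∪ freeImage v₁ v₂ π',
      z v ∈ insert (z i) (insert (z j) S) := by
    intro v hvU
    rcases Finset.mem_union.1 hvU with h | h
    · obtain ⟨w, -, rfl⟩ := Finset.mem_map.1 h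
      exact hcov w
    · obtain ⟨w, -, rfl⟩ := Finset.mem_map.1 h
      obtain ⟨w', hw'⟩ := hG.exists_label_eq (hπ₁.trans hπ'₁.symm) z hz w
      rw [hw']
      exact hcov w'
  have hlab := pow_le_labelSum hx i j _ z S hSD hU
  have h0 := pairMean_le hq hqp hp hlam hql z A B
  have hE : (A ∩ B).card ≤ G.edgeFinset.card := by
    rw [← card_edgeImage (G := G) π]
    exact Finset.card_le_card Finset.inter_subset_left
  have h1 : (2 : ℝ) ^ (A ∩ B).card ≤ 2 ^ G.edgeFinset.card :=
    pow_le_pow_right₀ one_le_two hE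
  -- The union has 2rD - |A ∩ B| ≥ r(2D - u) edges, and λ ≤ 1.
  have h2 : (p - q) ^ (A ∪ B).card ≤ ((p - q) ^ r) ^ (2 * D - u) := by
    rw [← Real.rpow_natCast, ← Real.rpow_natCast, ← Real.rpow_mul hl.le]
    refine Real.rpow_le_rpow_of_exponent_ge hl (by linarith) ?_
    have hi := hG.card_edgeImage_inter_le hr (hπ₁.trans hπ'₁.symm) (hπ₂.trans hπ'₂.symm)
    have hc : ((A ∪ B).card : ℝ) + (A ∩ B).card = G.edgeFinset.card + G.edgeFinset.card := by
      have := Finset.card_union_add_card_inter A B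
      rw [hA, hB, card_edgeImage, card_edgeImage] at this
      exact_mod_cast this
    have hc2 : (Fintype.card V : ℝ) - 2 = (D : ℕ) := by
      rw [hD, Nat.cast_sub hV2]; norm_num
    rw [hG.card_edges, hc2] at hc
    rw [Nat.cast_sub (by omega)]
    push_cast
    linarith
  have h3 : (q * (1 - q) / (p - q)) ^ ((A ∩ B).filter fun e => ¬ (e.1.map z).IsDiag).card ≤
      ((q * (1 - q) / (p - q)) ^ r) ^ S.card := by
    rw [← Real.rpow_natCast, ← Real.rpow_natCast, ← Real.rpow_mul hρ.le]
    exact Real.rpow_le_rpow_of_exponent_ge hρ hρ1 hcross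
  refine h0.trans (mul_le_mul (mul_le_mul h1 h2 (by positivity) (by positivity))
    (h3.trans hlab) (by positivity) ?_)
  positivity

end PairBound

/-! ### Averaging over the labels with those of the two roots fixed -/

section Average

open Classical

variable {V : Type} [Fintype V] {G : SimpleGraph V} {v₁ v₂ : V} {r : ℝ} {n K : ℕ}

/-- The labels `z`, with those of `i` and `j` replaced by `a` and `b`. -/
def relabel (i j : Fin n) (a b : Fin K) (z : Fin n → Fin K) : Fin n → Fin K :=
  Function.update (Function.update z i a) j b

theorem relabel_left {i j : Fin n} (hij : i ≠ j) (a b : Fin K) (z : Fin n → Fin K) :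
    relabel i j a b z i = a := by
  simp [relabel, hij]

theorem relabel_right (i j : Fin n) (a b : Fin K) (z : Fin n → Fin K) :
    relabel i j a b z j = b := by
  simp [relabel]

theorem relabel_of_ne {i j v : Fin n} (hi : v ≠ i) (hj : v ≠ j) (a b : Fin K)
    (z : Fin n → Fin K) : relabel i j a b z v = z v := by
  simp [relabel, hi, hj]

theorem integral_box_relabel [NeZero K] {i j : Fin n} (hij : i ≠ j) (a b : Fin K)
    (U : Finset (Fin n)) (hi : i ∉ U) (hj : j ∉ U) (S : Fin K → Fin K → Finset (Fin K)) :
    ∫ z, (if ∀ v ∈ U, relabel i j a b z v ∈ S (relabel i j a b z i) (relabel i j a b z j)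
      then (1 : ℝ) else 0) ∂labelLaw n K = (((S a b).card : ℝ) / K) ^ U.card := by
  rw [← integral_labelLaw_box U (S a b)]
  congr 1
  ext z
  rw [relabel_left hij, relabel_right]
  congr 1
  refine propext (forall₂_congr fun v hv => ?_)
  have hrel : relabel i j a b z v = z v :=
    relabel_of_ne (by rintro rfl; exact hi hv) (by rintro rfl; exact hj hv) a b z
  rw [hrel]

/-- The number of label sets of size s is at most K^s, and (Kx)^s ≤ 1, so each of the D + 1 sizes
contributes at most the probability that all of `U` falls in a fixed set of D + 2 labels. -/
theorem integral_labelSum_le [NeZero K] {x : ℝ} (hx : 0 ≤ x) (hKx : K * x ≤ 1) (D : ℕ)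
    {i j : Fin n} (hij : i ≠ j) (a b : Fin K) (U : Finset (Fin n)) (hi : i ∉ U) (hj : j ∉ U) :
    ∫ z, labelSum x D i j U (relabel i j a b z) ∂labelLaw n K ≤
      (D + 1) * (((D : ℝ) + 2) / K) ^ U.card := by
  unfold labelSum
  rw [integral_finsetSum _ fun _ _ => Integrable.of_finite]
  set c : ℝ := (((D : ℝ) + 2) / K) ^ U.card with hc
  have hc0 : 0 ≤ c := by positivity
  have h1 : ∀ S ∈ (Finset.univ : Finset (Fin K)).powerset,
      (∫ z, if S.card ≤ D then x ^ S.card * (if ∀ v ∈ U, relabel i j a b z v ∈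
        insert (relabel i j a b z i) (insert (relabel i j a b z j) S) then (1 : ℝ) else 0)
        else 0 ∂labelLaw n K) ≤ (fun m : ℕ => if m ≤ D then x ^ m * c else 0) S.card := by
    intro S _
    dsimp only
    split_ifs with hS
    · rw [integral_const_mul,
        integral_box_relabel hij a b U hi hj fun a b => insert a (insert b S)]
      refine mul_le_mul_of_nonneg_left ?_ (by positivity)
      refine pow_le_pow_left₀ (by positivity) ?_ _
      refine div_le_div_of_nonneg_right ?_ (by positivity)
      have h := Finset.card_insert_le a (insert b S)
      have h' := Finset.card_insert_le b S
      have : (insert a (insert b S)).card ≤ D + 2 := by omega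
      exact_mod_cast this
    · simp
  refine (Finset.sum_le_sum h1).trans ?_
  rw [Finset.sum_powerset_apply_card fun m : ℕ => if m ≤ D then x ^ m * c else 0]
  have h2 : ∀ m ∈ Finset.range ((Finset.univ : Finset (Fin K)).card + 1),
      (Finset.univ : Finset (Fin K)).card.choose m • (if m ≤ D then x ^ m * c else 0) ≤
        if m ∈ Finset.range (D + 1) then c else 0 := by
    intro m _
    simp only [Finset.mem_range, Nat.lt_succ_iff, Finset.card_univ, Fintype.card_fin]
    split_ifs with hm
    · rw [nsmul_eq_mul, ← mul_assoc]
      have h3 : (K.choose m : ℝ) ≤ (K : ℝ) ^ m := by exact_mod_cast Nat.choose_le_pow K m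
      have h4 : (K.choose m : ℝ) * x ^ m ≤ 1 := by
        calc (K.choose m : ℝ) * x ^ m ≤ (K : ℝ) ^ m * x ^ m := by gcongr
          _ = (K * x) ^ m := (mul_pow _ _ _).symm
          _ ≤ 1 := pow_le_one₀ (by positivity) hKx
      nlinarith
    · simp
  refine (Finset.sum_le_sum h2).trans ?_
  rw [← Finset.sum_filter]
  rw [Finset.sum_const, nsmul_eq_mul]
  refine mul_le_mul_of_nonneg_right ?_ hc0
  have : ((Finset.range ((Finset.univ : Finset (Fin K)).card + 1)).filter
      fun m => m ∈ Finset.range (D + 1)).card ≤ (Finset.range (D + 1)).card :=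
    Finset.card_le_card fun m hm => (Finset.mem_filter.1 hm).2
  rw [Finset.card_range] at this
  exact_mod_cast this

theorem IsBalancedMotif.label_eq_of_edgeImage (hG : IsBalancedMotif G v₁ v₂ r) {π : V ↪ Fin n}
    (z : Fin n → Fin K) (hz : ∀ e ∈ edgeImage G π, (e.1.map z).IsDiag) (v : V) :
    z (π v) = z (π v₁) := by
  by_contra hcon
  obtain ⟨a, b, hab, ha, hb⟩ := hG.exists_boundary_edge {x | z (π x) = z (π v)} (x := v)
    (y := v₁) rfl (fun h => hcon h.symm)
  have he : s(a, b) ∈ G.edgeFinset := by simpa using hab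
  have h := hz ⟨s(a, b).map π, map_not_isDiag he π⟩ (by
    simp only [edgeImage, Finset.mem_filter, Finset.mem_univ, true_and]
    exact ⟨s(a, b), he, rfl⟩)
  simp only [Sym2.map_mk, Sym2.mk_isDiag_iff] at h
  exact hb (h.symm.trans ha)

theorem IsBalancedMotif.two_le_card (hv : v₁ ≠ v₂) : 2 ≤ Fintype.card V := by
  have := Finset.card_le_univ ({v₁, v₂} : Finset V)
  rwa [Finset.card_pair hv] at this

theorem IsBalancedMotif.pow_card_edges (hG : IsBalancedMotif G v₁ v₂ r) (hv : v₁ ≠ v₂) {l : ℝ}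
    (hl : 0 < l) : l ^ G.edgeFinset.card = (l ^ r) ^ (Fintype.card V - 2) := by
  rw [← Real.rpow_natCast, ← Real.rpow_natCast, ← Real.rpow_mul hl.le, hG.card_edges,
    Nat.cast_sub (two_le_card hv)]
  norm_num

theorem mem_freeImage_iff {π : V ↪ Fin n} {a : Fin n} :
    a ∈ freeImage v₁ v₂ π ↔ ∃ v, v ≠ v₁ ∧ v ≠ v₂ ∧ π v = a := by
  simp [freeImage, and_assoc]

/-- Without common free vertices no edge is shared, so both copies must be monochromatic, and
connectivity forces equal labels at the roots. The constant is exactly 1, which lets this term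
cancel against the squared mean. -/
theorem IsBalancedMotif.pairMean_le_of_overlap_eq_zero (hG : IsBalancedMotif G v₁ v₂ r)
    (hr : 0 ≤ r) (hv : v₁ ≠ v₂) {p q : ℝ} (hq : 0 < q) (hqp : q < p) (hp : p < 1)
    (hlam : p - q ≤ 1 - 2 * q) (hql : q * (1 - q) ≤ p - q) (z : Fin n → Fin K)
    {π π' : V ↪ Fin n} {i j : Fin n} (hπ₁ : π v₁ = i) (hπ₂ : π v₂ = j) (hπ'₁ : π' v₁ = i)
    (hπ'₂ : π' v₂ = j) (hu : overlap v₁ v₂ π π' = 0) :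
    pairMean p q z (edgeImage G π) (edgeImage G π') ≤
      ((p - q) ^ r) ^ (2 * (Fintype.card V - 2)) * ((if z i = z j then 1 else 0) *
        if ∀ v ∈ freeImage v₁ v₂ π ∪ freeImage v₁ v₂ π', z v ∈ ({z i} : Finset (Fin K))
          then 1 else 0) := by
  have hl : 0 < p - q := by linarith
  have hi := hG.card_edgeImage_inter_le hr (hπ₁.trans hπ'₁.symm) (hπ₂.trans hπ'₂.symm)
  rw [hu, Nat.cast_zero, mul_zero] at hi
  have hAB : edgeImage G π ∩ edgeImage G π' = ∅ := by
    rw [← Finset.card_eq_zero]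
    exact_mod_cast le_antisymm hi (Nat.cast_nonneg _)
  by_cases hz : ∀ e ∈ symmDiff (edgeImage G π) (edgeImage G π'), (e.1.map z).IsDiag
  swap
  · push Not at hz
    obtain ⟨e, he, h⟩ := hz
    rw [pairMean_eq_zero z he h]
    refine mul_nonneg (by positivity) (mul_nonneg ?_ ?_) <;> split_ifs <;> norm_num
  have hdis : ∀ e, e ∈ edgeImage G π → e ∈ edgeImage G π' → False := by
    intro e h h'
    have : e ∈ edgeImage G π ∩ edgeImage G π' := Finset.mem_inter.2 ⟨h, h'⟩
    rw [hAB] at this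
    simp at this
  have h1 := hG.label_eq_of_edgeImage z fun e he =>
    hz e (Finset.mem_symmDiff.2 (Or.inl ⟨he, hdis e he⟩))
  have h2 := hG.label_eq_of_edgeImage z fun e he =>
    hz e (Finset.mem_symmDiff.2 (Or.inr ⟨he, fun h => hdis e h he⟩))
  have hij : z i = z j := by rw [← hπ₂, h1 v₂, hπ₁]
  rw [if_pos hij, if_pos, mul_one, mul_one]
  · refine (pairMean_le hq hqp hp hlam hql z _ _).trans ?_
    rw [hAB, Finset.card_union_of_disjoint (Finset.disjoint_iff_inter_eq_empty.2 hAB),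
      card_edgeImage, card_edgeImage, ← two_mul, pow_mul', hG.pow_card_edges hv hl, ← pow_mul']
    simp
  · intro v hvU
    rw [Finset.mem_singleton]
    rcases Finset.mem_union.1 hvU with h | h
    · obtain ⟨w, -, -, rfl⟩ := mem_freeImage_iff.1 h
      rw [h1 w, hπ₁]
    · obtain ⟨w, -, -, rfl⟩ := mem_freeImage_iff.1 h
      rw [h2 w, hπ'₁]

theorem IsBalancedMotif.le_pairMean_empty (hG : IsBalancedMotif G v₁ v₂ r)
    (hv : v₁ ≠ v₂) {p q : ℝ} (hqp : q < p) (z : Fin n → Fin K)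
    {π : V ↪ Fin n} {i j : Fin n} (hπ₁ : π v₁ = i) (hπ₂ : π v₂ = j) (hij : z i = z j) :
    ((p - q) ^ r) ^ (Fintype.card V - 2) *
        (if ∀ v ∈ freeImage v₁ v₂ π, z v ∈ ({z i} : Finset (Fin K)) then 1 else 0) ≤
      pairMean p q z (edgeImage G π) ∅ := by
  have hl : 0 < p - q := by linarith
  rw [pairMean_empty]
  split_ifs with h
  · have h1 : ∀ v, z (π v) = z i := by
      intro v
      by_cases h1 : v = v₁
      · rw [h1, hπ₁]
      by_cases h2 : v = v₂
      · rw [h2, hπ₂, hij]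
      exact Finset.mem_singleton.1 (h _ (mem_freeImage_iff.2 ⟨v, h1, h2, rfl⟩))
    have h2 : ∀ e ∈ edgeImage G π, (p - q) * sameLabel z e = p - q := by
      intro e he
      simp only [edgeImage, Finset.mem_filter, Finset.mem_univ, true_and] at he
      obtain ⟨e', -, he'⟩ := he
      have : (e.1.map z).IsDiag := by
        rw [← he', Sym2.map_map]
        induction e' using Sym2.ind with
        | h x y => simp [h1]
      rw [sameLabel, if_pos this, mul_one]
    rw [Finset.prod_congr rfl h2, Finset.prod_const, card_edgeImage, hG.pow_card_edges hv hl,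
      mul_one]
  · rw [mul_zero]
    refine Finset.prod_nonneg fun e _ => ?_
    rcases sameLabel_eq_zero_or_one z e with h | h <;> rw [h] <;> simp [hl.le]

end Average

/-! ### Rooted embeddings and the conditional squared deviation -/

section SecondMoment

open Classical

variable {V : Type} [Fintype V] {G : SimpleGraph V} {v₁ v₂ : V} {r : ℝ} {n K : ℕ}

/-- The injections `V → {i, j} ∪ J` that map `v₁` to `i` and `v₂` to `j`. -/
noncomputable def rootedEmbeddings (v₁ v₂ : V) (i j : Fin n) (J : Finset (Fin n)) :
    Finset (V ↪ Fin n) :=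
  Finset.univ.filter fun π => π v₁ = i ∧ π v₂ = j ∧ ∀ v, π v ∈ insert i (insert j J)

theorem mem_rootedEmbeddings {i j : Fin n} {J : Finset (Fin n)} {π : V ↪ Fin n} :
    π ∈ rootedEmbeddings v₁ v₂ i j J ↔
      π v₁ = i ∧ π v₂ = j ∧ ∀ v, π v ∈ insert i (insert j J) := by
  simp [rootedEmbeddings]

theorem mem_of_mem_rootedEmbeddings {i j : Fin n} {J : Finset (Fin n)} {π : V ↪ Fin n}
    (hπ : π ∈ rootedEmbeddings v₁ v₂ i j J) {v : V} (h₁ : v ≠ v₁) (h₂ : v ≠ v₂) : π v ∈ J := by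
  obtain ⟨h1, h2, h3⟩ := mem_rootedEmbeddings.1 hπ
  rcases Finset.mem_insert.1 (h3 v) with h | h
  · exact absurd (π.injective (h.trans h1.symm)) h₁
  rcases Finset.mem_insert.1 h with h | h
  · exact absurd (π.injective (h.trans h2.symm)) h₂
  · exact h

theorem freeImage_subset {i j : Fin n} {J : Finset (Fin n)} {π : V ↪ Fin n}
    (hπ : π ∈ rootedEmbeddings v₁ v₂ i j J) : freeImage v₁ v₂ π ⊆ J := by
  intro a ha
  obtain ⟨v, h1, h2, rfl⟩ := mem_freeImage_iff.1 ha
  exact mem_of_mem_rootedEmbeddings hπ h1 h2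

theorem exists_rooted_extension (hv : v₁ ≠ v₂) {i j : Fin n} (hij : i ≠ j)
    {J : Finset (Fin n)} (hi : i ∉ J) (hj : j ∉ J)
    (f : {v // v ∈ (Finset.univ \ {v₁, v₂} : Finset V)} ↪ {a // a ∈ J}) :
    ∃ g ∈ rootedEmbeddings v₁ v₂ i j J, ∀ v, g v.1 = f v := by
  obtain ⟨g, hg, hg1, hg2⟩ : ∃ g : V → Fin n, (∀ v, g v.1 = f v) ∧ g v₁ = i ∧ g v₂ = j := by
    refine ⟨fun v => if h : v ∈ (Finset.univ \ {v₁, v₂} : Finset V) then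
      (f ⟨v, h⟩ : Fin n) else if v = v₁ then i else j, fun v => ?_, ?_, ?_⟩
    · exact dif_pos v.2
    · simp
    · simp [hv.symm]
  have hcases : ∀ v, v = v₁ ∨ v = v₂ ∨
      ∃ w : {v // v ∈ (Finset.univ \ {v₁, v₂} : Finset V)}, w.1 = v := by
    intro v
    by_cases h : v ∈ (Finset.univ \ {v₁, v₂} : Finset V)
    · exact Or.inr (Or.inr ⟨⟨v, h⟩, rfl⟩)
    · simp only [Finset.mem_sdiff, Finset.mem_univ, true_and, Finset.mem_insert,
        Finset.mem_singleton, not_not] at h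
      tauto
  have hfi : ∀ w, (f w : Fin n) ≠ i := fun w h => hi (by rw [← h]; exact (f w).2)
  have hfj : ∀ w, (f w : Fin n) ≠ j := fun w h => hj (by rw [← h]; exact (f w).2)
  have hginj : Function.Injective g := by
    intro v w hvw
    rcases hcases v with h | h | ⟨v', h⟩ <;> rcases hcases w with h' | h' | ⟨w', h'⟩
    · exact h.trans h'.symm
    · rw [h, h', hg1, hg2] at hvw
      exact absurd hvw hij
    · rw [h, ← h', hg1, hg] at hvw
      exact absurd hvw.symm (hfi w')
    · rw [h, h', hg1, hg2] at hvw
      exact absurd hvw.symm hij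
    · exact h.trans h'.symm
    · rw [h, ← h', hg2, hg] at hvw
      exact absurd hvw.symm (hfj w')
    · rw [← h, h', hg1, hg] at hvw
      exact absurd hvw (hfi v')
    · rw [← h, h', hg2, hg] at hvw
      exact absurd hvw (hfj v')
    · rw [← h, ← h', hg, hg] at hvw
      rw [← h, ← h', f.injective (Subtype.ext hvw)]
  refine ⟨⟨g, hginj⟩, mem_rootedEmbeddings.2 ⟨hg1, hg2, fun v => ?_⟩, hg⟩
  change g v ∈ _
  rcases hcases v with h | h | ⟨v, rfl⟩
  · rw [h, hg1]; exact Finset.mem_insert_self _ _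
  · rw [h, hg2]; exact Finset.mem_insert_of_mem (Finset.mem_insert_self _ _)
  · rw [hg]
    exact Finset.mem_insert_of_mem (Finset.mem_insert_of_mem (f v).2)

theorem card_rootedEmbeddings (hv : v₁ ≠ v₂) {i j : Fin n} (hij : i ≠ j) {J : Finset (Fin n)}
    (hi : i ∉ J) (hj : j ∉ J) :
    (rootedEmbeddings v₁ v₂ i j J).card = J.card.descFactorial (Fintype.card V - 2) := by
  have h : Fintype.card ({v // v ∈ (Finset.univ \ {v₁, v₂} : Finset V)} ↪ {a // a ∈ J}) =
      J.card.descFactorial (Fintype.card V - 2) := by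
    rw [Fintype.card_embedding_eq, Fintype.card_coe, Fintype.card_coe, card_sdiff_pair hv]
  rw [← h, ← Finset.card_univ]
  have hne : ∀ v : {v // v ∈ (Finset.univ \ {v₁, v₂} : Finset V)}, v.1 ≠ v₁ ∧ v.1 ≠ v₂ := by
    intro v
    have := v.2
    simpa only [Finset.mem_sdiff, Finset.mem_univ, true_and, Finset.mem_insert,
      Finset.mem_singleton, not_or] using this
  refine Finset.card_bij (fun π hπ => ⟨fun v => ⟨π v.1,
    mem_of_mem_rootedEmbeddings hπ (hne v).1 (hne v).2⟩, fun v w hvw =>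
      Subtype.ext (π.injective (congrArg Subtype.val hvw))⟩) (fun _ _ => Finset.mem_univ _) ?_ ?_
  · intro π hπ π' hπ' heq
    ext v
    obtain ⟨h1, h2, -⟩ := mem_rootedEmbeddings.1 hπ
    obtain ⟨h1', h2', -⟩ := mem_rootedEmbeddings.1 hπ'
    by_cases e1 : v = v₁
    · rw [e1, h1, h1']
    by_cases e2 : v = v₂
    · rw [e2, h2, h2']
    have := congrArg (fun f : _ ↪ {a // a ∈ J} => ((f ⟨v, by simp [e1, e2]⟩ : {a // a ∈ J}) :
      Fin n)) heq
    exact congrArg Fin.val this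
  · intro f _
    obtain ⟨g, hg, hgf⟩ := exists_rooted_extension hv hij hi hj f
    refine ⟨g, hg, ?_⟩
    ext v
    exact congrArg Fin.val (hgf v)

/-- Dropping injectivity makes the sum factor over the free vertices. Each factor is at most |J| +
Dt, because at most D points of `J` lie in the free image of `π`. -/
theorem sum_pow_overlap_le (hv : v₁ ≠ v₂) {i j : Fin n} {J : Finset (Fin n)} (π : V ↪ Fin n)
    {t : ℝ} (ht : 0 ≤ t) :
    ∑ π' ∈ rootedEmbeddings v₁ v₂ i j J, t ^ overlap v₁ v₂ π π' ≤
      ((J.card : ℝ) + (Fintype.card V - 2 : ℕ) * t) ^ (Fintype.card V - 2) := by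
  let free : Finset V := Finset.univ \ {v₁, v₂}
  let g : V → Fin n → ℝ := fun v a => if v ∈ free then
    (if a ∈ freeImage v₁ v₂ π then t else 1) else 1
  let s : V → Finset (Fin n) := fun v => if v ∈ free then J else if v = v₁ then {i} else {j}
  have hg0 : ∀ v a, 0 ≤ g v a := by
    intro v a
    simp only [g]
    split_ifs <;> linarith
  have h1 : ∀ π' : V ↪ Fin n, t ^ overlap v₁ v₂ π π' = ∏ v, g v (π' v) := by
    intro π'
    simp only [g, Finset.prod_ite_mem, Finset.univ_inter, overlap]
    rw [Finset.prod_ite, Finset.prod_const, Finset.prod_const_one, mul_one]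
  have h2 : ∑ π' ∈ rootedEmbeddings v₁ v₂ i j J, t ^ overlap v₁ v₂ π π' ≤
      ∑ f ∈ Fintype.piFinset s, ∏ v, g v (f v) := by
    simp_rw [h1]
    rw [← Finset.sum_image (s := rootedEmbeddings v₁ v₂ i j J)
      (g := fun π' : V ↪ Fin n => (π' : V → Fin n)) (f := fun f => ∏ v, g v (f v))
      (fun a _ b _ h => DFunLike.coe_injective h)]
    refine Finset.sum_le_sum_of_subset_of_nonneg ?_ fun f _ _ =>
      Finset.prod_nonneg fun v _ => hg0 v _
    intro f hf
    obtain ⟨π', hπ', rfl⟩ := Finset.mem_image.1 hf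
    obtain ⟨h1, h2, -⟩ := mem_rootedEmbeddings.1 hπ'
    refine Fintype.mem_piFinset.2 fun v => ?_
    simp only [s]
    split_ifs with h h'
    · simp only [free, Finset.mem_sdiff, Finset.mem_univ, true_and, Finset.mem_insert,
        Finset.mem_singleton, not_or] at h
      exact mem_of_mem_rootedEmbeddings hπ' h.1 h.2
    · rw [h', h1]; simp
    · have : v = v₂ := by
        simp only [free, Finset.mem_sdiff, Finset.mem_univ, true_and, Finset.mem_insert,
          Finset.mem_singleton, not_not] at h
        tauto
      rw [this, h2]; simp
  refine h2.trans ?_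
  rw [← Finset.prod_univ_sum]
  have h3 : ∀ v, ∑ a ∈ s v, g v a =
      if v ∈ free then ∑ a ∈ J, (if a ∈ freeImage v₁ v₂ π then t else 1) else 1 := by
    intro v
    by_cases h : v ∈ free
    · simp only [s, g, h, if_true]
    · simp only [s, g, h, if_false]
      split_ifs <;> simp
  simp_rw [h3, Finset.prod_ite_mem, Finset.univ_inter, Finset.prod_const]
  rw [card_sdiff_pair hv]
  refine pow_le_pow_left₀ (Finset.sum_nonneg fun a _ => by split_ifs <;> linarith) ?_ _
  rw [Finset.sum_ite, Finset.sum_const, Finset.sum_const, nsmul_eq_mul, nsmul_eq_mul, mul_one,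
    add_comm]
  gcongr
  · exact Finset.filter_subset _ _
  · rw [← card_freeImage hv π]
    exact Finset.card_le_card fun a ha => (Finset.mem_filter.1 ha).2

/-- The conditional mean, given the labels, of the squared deviation of the count from `ρ`. -/
noncomputable def sqDev (G : SimpleGraph V) (P : Finset (V ↪ Fin n)) (p q ρ : ℝ)
    (z : Fin n → Fin K) : ℝ :=
  ∑ π ∈ P, ∑ π' ∈ P, pairMean p q z (edgeImage G π) (edgeImage G π') -
    2 * ρ * ∑ π ∈ P, pairMean p q z (edgeImage G π) ∅ + ρ ^ 2

theorem motifCount_eq (q : ℝ) (y : NodePair n → Bool) (i j : Fin n) (J : Finset (Fin n)) :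
    motifCount G v₁ v₂ q y i j J = ∑ π ∈ rootedEmbeddings v₁ v₂ i j J,
      ∏ e ∈ edgeImage G π, ((if y e then (1 : ℝ) else 0) - q) := by
  unfold motifCount rootedEmbeddings
  refine Finset.sum_congr (by congr!) fun π _ => ?_
  refine prod_edgeFinset_eq π _ _ fun e => ?_
  rw [centeredAdj, dif_neg e.2]

theorem integral_sq_motifCount_sub {p q : ℝ} (hq : 0 ≤ q) (hqp : q ≤ p) (hp : p ≤ 1) (ρ : ℝ)
    (z : Fin n → Fin K) (i j : Fin n) (J : Finset (Fin n)) :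
    ∫ y, (motifCount G v₁ v₂ q y i j J - ρ) ^ 2 ∂graphKernel n K p q z =
      sqDev G (rootedEmbeddings v₁ v₂ i j J) p q ρ z := by
  have h : ∀ y, (motifCount G v₁ v₂ q y i j J - ρ) ^ 2 =
      ∑ π ∈ rootedEmbeddings v₁ v₂ i j J, ∑ π' ∈ rootedEmbeddings v₁ v₂ i j J,
        ((∏ e ∈ edgeImage G π, ((if y e then (1 : ℝ) else 0) - q)) *
          ∏ e ∈ edgeImage G π', ((if y e then (1 : ℝ) else 0) - q)) -
      2 * ρ * ∑ π ∈ rootedEmbeddings v₁ v₂ i j J,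
        ((∏ e ∈ edgeImage G π, ((if y e then (1 : ℝ) else 0) - q)) *
          ∏ e ∈ (∅ : Finset (NodePair n)), ((if y e then (1 : ℝ) else 0) - q)) + ρ ^ 2 := by
    intro y
    rw [← Finset.sum_mul_sum, ← Finset.sum_mul, Finset.prod_empty, ← motifCount_eq]
    ring
  simp_rw [h]
  rw [integral_add Integrable.of_finite Integrable.of_finite,
    integral_sub Integrable.of_finite Integrable.of_finite,
    integral_finsetSum _ fun _ _ => Integrable.of_finite, integral_const_mul,
    integral_finsetSum _ fun _ _ => Integrable.of_finite]
  simp_rw [integral_finsetSum _ fun _ _ => Integrable.of_finite,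
    integral_graphKernel_pair hq hqp hp]
  simp [sqDev]

end SecondMoment

/-! ### Bound on the averaged squared deviation -/

section SecondMomentBound

open Classical

variable {V : Type} [Fintype V] {G : SimpleGraph V} {v₁ v₂ : V} {r : ℝ} {n K : ℕ}

/-- The combinatorial factor in the bound of the second moment. -/
noncomputable def momentConst (E D : ℕ) : ℝ := 2 ^ E * ((D + 1) * ((D : ℝ) + 2) ^ (2 * D))

theorem momentConst_pos (E D : ℕ) : 0 < momentConst E D := by
  unfold momentConst; positivity

namespace IsBalancedMotif

/-- The first moment enters the squared deviation with a nonpositive coefficient, so a lower bound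
suffices. It comes from the event that every free vertex takes the common label of the roots. -/
theorem le_integral_pairMean_empty [NeZero K] (hG : IsBalancedMotif G v₁ v₂ r) (hv : v₁ ≠ v₂)
    {p q : ℝ} (hqp : q < p) {i j : Fin n} (hij : i ≠ j) {J : Finset (Fin n)} (hi : i ∉ J)
    (hj : j ∉ J) (a : Fin K) {π : V ↪ Fin n} (hπ : π ∈ rootedEmbeddings v₁ v₂ i j J) :
    ((p - q) ^ r / K) ^ (Fintype.card V - 2) ≤
      ∫ z, pairMean p q (relabel i j a a z) (edgeImage G π) ∅ ∂labelLaw n K := by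
  obtain ⟨h1, h2, -⟩ := mem_rootedEmbeddings.1 hπ
  have hmono := integral_mono (μ := labelLaw n K) Integrable.of_finite Integrable.of_finite
    fun z => hG.le_pairMean_empty hv hqp (relabel i j a a z) h1 h2
      (by rw [relabel_left hij, relabel_right])
  simp_rw [relabel_left hij] at hmono
  rw [integral_const_mul] at hmono
  have hbox := integral_box_relabel hij a a _ (fun h => hi (freeImage_subset hπ h))
    (fun h => hj (freeImage_subset hπ h)) fun a _ => {a}
  simp_rw [relabel_left hij] at hbox
  rw [hbox, card_freeImage hv, Finset.card_singleton] at hmono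
  refine (le_of_eq ?_).trans hmono
  rw [div_pow, div_pow]
  push_cast
  ring

variable [NeZero K] (hG : IsBalancedMotif G v₁ v₂ r) (hr : 0 ≤ r) (hv : v₁ ≠ v₂) {p q : ℝ}
  (hq : 0 < q) (hqp : q < p) (hp : p < 1) (hlam : p - q ≤ 1 - 2 * q)
  (hql : q * (1 - q) ≤ p - q) {i j : Fin n} (hij : i ≠ j) {J : Finset (Fin n)} (hi : i ∉ J)
  (hj : j ∉ J)

include hG hr hv hq hqp hp hlam hql hij hi hj

/-- The two copies have 2D - u free vertices in their union, each worth Θ/K up to the combinatorial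
constant. Compared with two disjoint copies, every common vertex costs a factor K/Θ. -/
theorem integral_pairMean_le (hKx : K * (q * (1 - q) / (p - q)) ^ r ≤ 1) (a b : Fin K)
    {π π' : V ↪ Fin n} (hπ : π ∈ rootedEmbeddings v₁ v₂ i j J)
    (hπ' : π' ∈ rootedEmbeddings v₁ v₂ i j J) :
    ∫ z, pairMean p q (relabel i j a b z) (edgeImage G π) (edgeImage G π') ∂labelLaw n K ≤
      momentConst G.edgeFinset.card (Fintype.card V - 2) *
        (((p - q) ^ r / K) ^ (Fintype.card V - 2)) ^ 2 *
        (K / (p - q) ^ r) ^ overlap v₁ v₂ π π' := by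
  obtain ⟨h1, h2, -⟩ := mem_rootedEmbeddings.1 hπ
  obtain ⟨h1', h2', -⟩ := mem_rootedEmbeddings.1 hπ'
  have hl : 0 < p - q := by linarith
  have hΘ : 0 < (p - q) ^ r := Real.rpow_pos_of_pos hl r
  have hK : (0 : ℝ) < K := by exact_mod_cast NeZero.pos K
  have hx : 0 ≤ (q * (1 - q) / (p - q)) ^ r :=
    Real.rpow_nonneg (div_nonneg (mul_nonneg hq.le (by linarith)) hl.le) r
  have hU : ∀ a ∉ J, a ∉ freeImage v₁ v₂ π ∪ freeImage v₁ v₂ π' := by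
    intro a ha h
    rcases Finset.mem_union.1 h with h | h
    · exact ha (freeImage_subset hπ h)
    · exact ha (freeImage_subset hπ' h)
  have huD := overlap_le hv π π'
  have hmono := integral_mono (μ := labelLaw n K) Integrable.of_finite Integrable.of_finite
    fun z => hG.pairMean_le_labelSum hr hv hq hqp hp hlam hql (relabel i j a b z) h1 h2 h1' h2'
  rw [integral_const_mul] at hmono
  refine hmono.trans ?_
  have hlab := integral_labelSum_le hx hKx (Fintype.card V - 2) hij a b _ (hU i hi) (hU j hj)
  rw [card_freeImage_union hv] at hlab
  generalize Fintype.card V - 2 = D at *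
  generalize overlap v₁ v₂ π π' = u at *
  generalize (p - q) ^ r = Θ at *
  have hD2 : ((D : ℝ) + 2) ^ (2 * D - u) ≤ ((D : ℝ) + 2) ^ (2 * D) :=
    pow_le_pow_right₀ (by linarith [Nat.cast_nonneg (α := ℝ) D]) (Nat.sub_le _ _)
  have hpow : (Θ / K) ^ (2 * D - u) = ((Θ / K) ^ D) ^ 2 * (K / Θ) ^ u := by
    have hpos : 0 < (Θ / K) ^ u := by positivity
    have : (K / Θ) ^ u = ((Θ / K) ^ u)⁻¹ := by rw [← inv_pow, inv_div]
    rw [this, ← div_eq_mul_inv, eq_div_iff hpos.ne', ← pow_add, ← pow_mul]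
    congr 1
    omega
  calc 2 ^ G.edgeFinset.card * Θ ^ (2 * D - u) *
        ∫ z, labelSum ((q * (1 - q) / (p - q)) ^ r) D i j
          (freeImage v₁ v₂ π ∪ freeImage v₁ v₂ π') (relabel i j a b z) ∂labelLaw n K
      ≤ 2 ^ G.edgeFinset.card * Θ ^ (2 * D - u) *
        ((D + 1) * (((D : ℝ) + 2) / K) ^ (2 * D - u)) := by gcongr
    _ = 2 ^ G.edgeFinset.card * ((D + 1) * ((D : ℝ) + 2) ^ (2 * D - u)) *
        (Θ / K) ^ (2 * D - u) := by rw [div_pow, div_pow]; ring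
    _ ≤ 2 ^ G.edgeFinset.card * ((D + 1) * ((D : ℝ) + 2) ^ (2 * D)) *
        (Θ / K) ^ (2 * D - u) := by gcongr
    _ = _ := by rw [hpow, momentConst]; ring

theorem integral_pairMean_le_of_overlap_eq_zero (a b : Fin K)
    {π π' : V ↪ Fin n} (hπ : π ∈ rootedEmbeddings v₁ v₂ i j J)
    (hπ' : π' ∈ rootedEmbeddings v₁ v₂ i j J) (hu : overlap v₁ v₂ π π' = 0) :
    ∫ z, pairMean p q (relabel i j a b z) (edgeImage G π) (edgeImage G π') ∂labelLaw n K ≤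
      (((p - q) ^ r / K) ^ (Fintype.card V - 2)) ^ 2 * if a = b then 1 else 0 := by
  obtain ⟨h1, h2, -⟩ := mem_rootedEmbeddings.1 hπ
  obtain ⟨h1', h2', -⟩ := mem_rootedEmbeddings.1 hπ'
  have hU : ∀ a ∉ J, a ∉ freeImage v₁ v₂ π ∪ freeImage v₁ v₂ π' := by
    intro a ha h
    rcases Finset.mem_union.1 h with h | h
    · exact ha (freeImage_subset hπ h)
    · exact ha (freeImage_subset hπ' h)
  have hmono := integral_mono (μ := labelLaw n K) Integrable.of_finite Integrable.of_finite
    fun z => hG.pairMean_le_of_overlap_eq_zero hr hv hq hqp hp hlam hql (relabel i j a b z)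
      h1 h2 h1' h2' hu
  simp_rw [relabel_left hij, relabel_right] at hmono
  rw [integral_const_mul, integral_const_mul] at hmono
  have hbox := integral_box_relabel hij a b _ (hU i hi) (hU j hj) fun a _ => {a}
  simp_rw [relabel_left hij] at hbox
  rw [hbox, card_freeImage_union hv, hu, Finset.card_singleton, Nat.sub_zero] at hmono
  refine hmono.trans (le_of_eq ?_)
  rw [← pow_mul, mul_comm (Fintype.card V - 2) 2, div_pow, div_pow]
  push_cast
  ring

/-- Pairs without overlap give at most the squared target, which the other two terms of the squared
deviation cancel; every other pair keeps a small factor DK/(Θ|J|). -/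
theorem integral_sqDev_le (hKx : K * (q * (1 - q) / (p - q)) ^ r ≤ 1) (a b : Fin K)
    (hD : 0 < Fintype.card V - 2) (hB : 2 * (Fintype.card V - 2) ≤ J.card)
    (hε : (Fintype.card V - 2 : ℕ) * K / ((p - q) ^ r * J.card) ≤ 1) :
    ∫ z, sqDev G (rootedEmbeddings v₁ v₂ i j J) p q
        (if a = b then (J.card.descFactorial (Fintype.card V - 2) : ℝ) *
          ((p - q) ^ r / K) ^ (Fintype.card V - 2) else 0) (relabel i j a b z) ∂labelLaw n K ≤
      ((J.card.descFactorial (Fintype.card V - 2) : ℝ) *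
          ((p - q) ^ r / K) ^ (Fintype.card V - 2)) ^ 2 *
        (momentConst G.edgeFinset.card (Fintype.card V - 2) * 4 ^ (Fintype.card V - 2) *
          ((Fintype.card V - 2 : ℕ) * K / ((p - q) ^ r * J.card))) := by
  have hl : 0 < p - q := by linarith
  have hΘ : 0 < (p - q) ^ r := Real.rpow_pos_of_pos hl r
  have hK : (0 : ℝ) < K := by exact_mod_cast NeZero.pos K
  have hC := momentConst_pos G.edgeFinset.card (Fintype.card V - 2)
  have hpair := fun π hπ π' hπ' => hG.integral_pairMean_le hr hv hq hqp hp hlam hql hij hi hj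
    hKx a b (π := π) (π' := π') hπ hπ'
  have hpair0 := fun π hπ π' hπ' => hG.integral_pairMean_le_of_overlap_eq_zero hr hv hq hqp hp
    hlam hql hij hi hj a b (π := π) (π' := π') hπ hπ'
  have hone := fun π hπ => hG.le_integral_pairMean_empty hv hqp hij hi hj a (π := π) hπ
  have hcard := card_rootedEmbeddings hv hij hi hj
  -- With t = |J|/D the bound becomes (2|J|)^D, which is at most 4^D times the number of embeddings
  -- by `hdesc`. The cost K/Θ of a common vertex equals εt.
  have hsum := fun π : V ↪ Fin n => sum_pow_overlap_le (t := (J.card : ℝ) /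
    (Fintype.card V - 2 : ℕ)) hv (i := i) (j := j) (J := J) π (by positivity)
  have hdesc : ((J.card : ℝ) / 2) ^ (Fintype.card V - 2) ≤
      J.card.descFactorial (Fintype.card V - 2) := by
    calc ((J.card : ℝ) / 2) ^ (Fintype.card V - 2)
        ≤ ((J.card + 1 - (Fintype.card V - 2) : ℕ) : ℝ) ^ (Fintype.card V - 2) := by
          refine pow_le_pow_left₀ (by positivity) ?_ _
          rw [div_le_iff₀ two_pos]
          have : J.card ≤ (J.card + 1 - (Fintype.card V - 2)) * 2 := by omega
          exact_mod_cast this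
      _ ≤ _ := by exact_mod_cast Nat.pow_sub_le_descFactorial _ _
  set D := Fintype.card V - 2 with hDdef
  set P := rootedEmbeddings v₁ v₂ i j J with hP
  set Θ := (p - q) ^ r with hΘdef
  set M : ℝ := (J.card.descFactorial D : ℝ) with hM
  set τ := (Θ / K) ^ D with hτ
  set C := momentConst G.edgeFinset.card D with hCdef
  set ε : ℝ := (D : ℝ) * K / (Θ * J.card) with hεdef
  have hD' : (0 : ℝ) < D := by exact_mod_cast hD
  have hB' : (0 : ℝ) < J.card := by
    have : 0 < J.card := by omega
    exact_mod_cast this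
  have hε0 : 0 < ε := by positivity
  have hτ0 : 0 < τ := by positivity
  have hM0 : 0 ≤ M := Nat.cast_nonneg _
  have hcardP : (P.card : ℝ) = M := by rw [hcard]
  set t : ℝ := (J.card : ℝ) / D with ht
  have hκ : K / Θ = ε * t := by
    rw [hεdef, ht]; field_simp
  have hpt : ∀ π ∈ P, ∀ π' ∈ P,
      ∫ z, pairMean p q (relabel i j a b z) (edgeImage G π) (edgeImage G π') ∂labelLaw n K ≤
        τ ^ 2 * (if a = b then 1 else 0) + C * τ ^ 2 * ε * t ^ overlap v₁ v₂ π π' := by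
    intro π hπ π' hπ'
    have ht0 : 0 ≤ t ^ overlap v₁ v₂ π π' := by positivity
    have hi0 : (0 : ℝ) ≤ if a = b then 1 else 0 := by split_ifs <;> norm_num
    rcases Nat.eq_zero_or_pos (overlap v₁ v₂ π π') with hu | hu
    · have := hpair0 π hπ π' hπ' hu
      have h' : 0 ≤ C * τ ^ 2 * ε * t ^ overlap v₁ v₂ π π' := by positivity
      linarith
    · refine (hpair π hπ π' hπ').trans ?_
      -- A positive overlap leaves at least one factor ε, which is the gain; t^u is kept for the
      -- sum.
      have h' : ε ^ overlap v₁ v₂ π π' ≤ ε := pow_le_of_le_one hε0.le hε hu.ne'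
      rw [hκ, mul_pow]
      have h'' : C * τ ^ 2 * (ε ^ overlap v₁ v₂ π π' * t ^ overlap v₁ v₂ π π') ≤
          C * τ ^ 2 * (ε * t ^ overlap v₁ v₂ π π') := by gcongr
      have h3 : 0 ≤ τ ^ 2 * (if a = b then (1 : ℝ) else 0) := by positivity
      linarith
  have hDt : (D : ℝ) * t = J.card := by rw [ht]; field_simp
  have h4 : ((J.card : ℝ) + D * t) ^ D ≤ 4 ^ D * M := by
    rw [hDt]
    calc ((J.card : ℝ) + J.card) ^ D = 4 ^ D * ((J.card : ℝ) / 2) ^ D := by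
          rw [← mul_pow]; congr 1; ring
      _ ≤ _ := by gcongr
  have hdouble : ∑ π ∈ P, ∑ π' ∈ P,
      ∫ z, pairMean p q (relabel i j a b z) (edgeImage G π) (edgeImage G π') ∂labelLaw n K ≤
        M ^ 2 * τ ^ 2 * (if a = b then 1 else 0) + (M * τ) ^ 2 * (C * 4 ^ D * ε) := by
    calc _ ≤ ∑ π ∈ P, ∑ π' ∈ P, (τ ^ 2 * (if a = b then 1 else 0) +
            C * τ ^ 2 * ε * t ^ overlap v₁ v₂ π π') :=
          Finset.sum_le_sum fun π hπ => Finset.sum_le_sum fun π' hπ' => hpt π hπ π' hπ'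
      _ ≤ ∑ π ∈ P, (M * (τ ^ 2 * (if a = b then 1 else 0)) +
            C * τ ^ 2 * ε * (4 ^ D * M)) := by
          refine Finset.sum_le_sum fun π hπ => ?_
          rw [Finset.sum_add_distrib, Finset.sum_const, nsmul_eq_mul, hcardP, ← Finset.mul_sum]
          gcongr
          exact (hsum π).trans h4
      _ = _ := by
          rw [Finset.sum_const, nsmul_eq_mul, hcardP]; ring
  clear_value M τ C ε
  unfold sqDev
  rw [integral_add Integrable.of_finite Integrable.of_finite,
    integral_sub Integrable.of_finite Integrable.of_finite,
    integral_finsetSum _ fun _ _ => Integrable.of_finite, integral_const_mul,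
    integral_finsetSum _ fun _ _ => Integrable.of_finite]
  simp_rw [integral_finsetSum _ fun _ _ => Integrable.of_finite]
  rw [integral_const, probReal_univ, one_smul]
  -- For equal labels the leading terms are (Mτ)² - 2(Mτ)² + (Mτ)² = 0; for distinct labels the
  -- target and the leading term both vanish.
  by_cases hab : a = b
  · subst hab
    simp only [if_true, mul_one] at hdouble ⊢
    have h5 : M * τ ≤
        ∑ π ∈ P, ∫ z, pairMean p q (relabel i j a a z) (edgeImage G π) ∅ ∂labelLaw n K := by
      calc M * τ = ∑ π ∈ P, τ := by rw [Finset.sum_const, nsmul_eq_mul, hcardP]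
        _ ≤ _ := Finset.sum_le_sum fun π hπ => hone π hπ
    have h6 : 0 ≤ M * τ := mul_nonneg hM0 hτ0.le
    have h7 := mul_le_mul_of_nonneg_left h5 h6
    linarith
  · simp only [hab, if_false, mul_zero] at hdouble ⊢
    linarith

end IsBalancedMotif

end SecondMomentBound

/-! ### Independence of the blocks and the median -/

section Blocks

open Classical

variable {V : Type} [Fintype V] {G : SimpleGraph V} {v₁ v₂ : V} {r : ℝ} {n K L : ℕ}

theorem mem_of_mem_edgeImage {i j : Fin n} {J : Finset (Fin n)} {π : V ↪ Fin n}
    (hπ : π ∈ rootedEmbeddings v₁ v₂ i j J) {e : NodePair n} (he : e ∈ edgeImage G π)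
    {v : Fin n} (hv : v ∈ e.1) : v ∈ insert i (insert j J) := by
  simp only [edgeImage, Finset.mem_filter, Finset.mem_univ, true_and] at he
  obtain ⟨e', -, he'⟩ := he
  rw [← he', Sym2.mem_map] at hv
  obtain ⟨w, -, rfl⟩ := hv
  exact (mem_rootedEmbeddings.1 hπ).2.2 w

/-- The node pairs used by the counts on the block `J`. -/
noncomputable def blockPairs (i j : Fin n) (J : Finset (Fin n)) : Finset (NodePair n) :=
  Finset.univ.filter fun e => e.1 ≠ s(i, j) ∧ ∀ v, v ∈ e.1 → v ∈ insert i (insert j J)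

/-- A pair inside both root-extended blocks can only be {i, j}, which is excluded. The motif never
uses it, as `v₁ v₂` is not an edge. -/
theorem disjoint_blockPairs {i j : Fin n} {J J' : Finset (Fin n)} (h : Disjoint J J') :
    Disjoint (blockPairs i j J) (blockPairs i j J') := by
  rw [Finset.disjoint_left]
  intro e he he'
  simp only [blockPairs, Finset.mem_filter, Finset.mem_univ, true_and] at he he'
  have hmem : ∀ v ∈ e.1, v = i ∨ v = j := by
    intro v hv
    have h1 := he.2 v hv
    have h2 := he'.2 v hv
    simp only [Finset.mem_insert] at h1 h2
    by_contra hne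
    exact Finset.disjoint_left.1 h (show v ∈ J by tauto) (show v ∈ J' by tauto)
  obtain ⟨e, hd⟩ := e
  induction e using Sym2.ind with
  | h x y =>
    have hxy : x ≠ y := by simpa using hd
    have hx := hmem x (by simp)
    have hy := hmem y (by simp)
    apply he.1
    rcases hx with rfl | rfl <;> rcases hy with rfl | rfl
    · exact absurd rfl hxy
    · rfl
    · exact Sym2.eq_swap
    · exact absurd rfl hxy

theorem IsBalancedMotif.edgeImage_subset_blockPairs (hG : IsBalancedMotif G v₁ v₂ r)
    {i j : Fin n} {J : Finset (Fin n)} {π : V ↪ Fin n}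
    (hπ : π ∈ rootedEmbeddings v₁ v₂ i j J) : edgeImage G π ⊆ blockPairs i j J := by
  intro e he
  refine Finset.mem_filter.2 ⟨Finset.mem_univ _, fun h => ?_, fun v hv =>
    mem_of_mem_edgeImage hπ he hv⟩
  simp only [edgeImage, Finset.mem_filter, Finset.mem_univ, true_and] at he
  obtain ⟨e', he', h'⟩ := he
  obtain ⟨h1, h2, -⟩ := mem_rootedEmbeddings.1 hπ
  have : e' = s(v₁, v₂) := by
    apply Sym2.map.injective π.injective
    rw [h', h, Sym2.map_mk, h1, h2]
  rw [this, SimpleGraph.mem_edgeFinset, SimpleGraph.mem_edgeSet] at he'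
  exact hG.not_adj he'

theorem IsBalancedMotif.dependsOn_motifCount (hG : IsBalancedMotif G v₁ v₂ r) (q : ℝ)
    (i j : Fin n) (J : Finset (Fin n)) :
    DependsOn (fun y : NodePair n → Bool => motifCount G v₁ v₂ q y i j J)
      (blockPairs i j J : Set (NodePair n)) := by
  intro y y' h
  dsimp only
  rw [motifCount_eq, motifCount_eq]
  refine Finset.sum_congr rfl fun π hπ => Finset.prod_congr rfl fun e he => ?_
  rw [h e (Finset.mem_coe.2 (hG.edgeImage_subset_blockPairs hπ he))]

theorem pairMean_congr {p q : ℝ} {z z' : Fin n → Fin K} {A B : Finset (NodePair n)}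
    (h : ∀ e ∈ A ∪ B, sameLabel z e = sameLabel z' e) :
    pairMean p q z A B = pairMean p q z' A B := by
  unfold pairMean
  congr 1
  · refine Finset.prod_congr rfl fun e he => ?_
    rw [h e (Finset.mem_union_left _ (Finset.mem_inter.1 he).1)]
  · refine Finset.prod_congr rfl fun e he => ?_
    rw [h e]
    rcases Finset.mem_symmDiff.1 he with h | h
    · exact Finset.mem_union_left _ h.1
    · exact Finset.mem_union_right _ h.1

theorem dependsOn_sqDev {i j : Fin n} (hij : i ≠ j) (J : Finset (Fin n)) (p q ρ : ℝ)
    (a b : Fin K) :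
    DependsOn (fun z => sqDev G (rootedEmbeddings v₁ v₂ i j J) p q ρ (relabel i j a b z))
      (J : Set (Fin n)) := by
  intro z z' h
  have h0 : ∀ v ∈ insert i (insert j J), relabel i j a b z v = relabel i j a b z' v := by
    intro v hv
    by_cases hvi : v = i
    · rw [hvi, relabel_left hij, relabel_left hij]
    by_cases hvj : v = j
    · rw [hvj, relabel_right, relabel_right]
    rw [relabel_of_ne hvi hvj, relabel_of_ne hvi hvj]
    refine h v (Finset.mem_coe.2 ?_)
    simpa [hvi, hvj] using hv
  have h1 : ∀ π ∈ rootedEmbeddings v₁ v₂ i j J, ∀ e ∈ edgeImage G π,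
      sameLabel (relabel i j a b z) e = sameLabel (relabel i j a b z') e := by
    intro π hπ e he
    unfold sameLabel
    rw [Sym2.map_congr fun v hv => h0 v (mem_of_mem_edgeImage hπ he hv)]
  dsimp only [sqDev]
  congr 2
  · refine Finset.sum_congr rfl fun π hπ => Finset.sum_congr rfl fun π' hπ' =>
      pairMean_congr fun e he => ?_
    rcases Finset.mem_union.1 he with h | h
    · exact h1 π hπ e h
    · exact h1 π' hπ' e h
  · congr 1
    refine Finset.sum_congr rfl fun π hπ => pairMean_congr fun e he => ?_
    rw [Finset.union_empty] at he
    exact h1 π hπ e he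

/-- The blocks give independent counts once the labels of `i` and `j` are fixed. -/
theorem IsBalancedMotif.integral_prod_blocks_le [NeZero K] (hG : IsBalancedMotif G v₁ v₂ r)
    {p q : ℝ} (hq : 0 ≤ q) (hqp : q ≤ p) (hp : p ≤ 1) {i j : Fin n} (hij : i ≠ j)
    (J : Fin L → Finset (Fin n)) (hdisj : ∀ l l', l ≠ l' → Disjoint (J l) (J l')) (T c : ℝ)
    (hc : 0 ≤ c)
    (hdev : ∀ l a b, c * ∫ z, sqDev G (rootedEmbeddings v₁ v₂ i j (J l)) p q
      (if a = b then T else 0) (relabel i j a b z) ∂labelLaw n K ≤ 1) :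
    ∫ z, ∫ y, ∏ l, (1 + c * (motifCount G v₁ v₂ q y i j (J l) -
      if z i = z j then T else 0) ^ 2) ∂graphKernel n K p q z ∂labelLaw n K ≤ 2 ^ L := by
  have h1 : ∀ z : Fin n → Fin K, ∀ l, ∫ y, (1 + c * (motifCount G v₁ v₂ q y i j (J l) -
      if z i = z j then T else 0) ^ 2) ∂graphKernel n K p q z =
        1 + c * sqDev G (rootedEmbeddings v₁ v₂ i j (J l)) p q (if z i = z j then T else 0) z := by
    intro z l
    rw [integral_add Integrable.of_finite Integrable.of_finite, integral_const, probReal_univ,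
      one_smul, integral_const_mul, integral_sq_motifCount_sub hq hqp hp]
  -- First independence: given all labels, the counts read disjoint sets of node pairs.
  have h2 : ∀ z : Fin n → Fin K, ∫ y, ∏ l, (1 + c * (motifCount G v₁ v₂ q y i j (J l) -
      if z i = z j then T else 0) ^ 2) ∂graphKernel n K p q z =
      ∏ l, (1 + c * sqDev G (rootedEmbeddings v₁ v₂ i j (J l)) p q
        (if z i = z j then T else 0) z) := by
    intro z
    simp_rw [← h1]
    rw [graphKernel_apply]
    refine integral_pi_prod_of_dependsOn _ (fun l => blockPairs i j (J l))
      (fun l l' h => disjoint_blockPairs (hdisj l l' h)) _ fun l y y' hy => ?_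
    have := hG.dependsOn_motifCount q i j (J l) hy
    dsimp only at this ⊢
    rw [this]
  simp_rw [h2]
  have hnn : ∀ z : Fin n → Fin K, ∀ l, 0 ≤ 1 + c * sqDev G (rootedEmbeddings v₁ v₂ i j (J l)) p q
      (if z i = z j then T else 0) z := by
    intro z l
    rw [← h1]
    exact integral_nonneg fun y => by positivity
  -- Second independence: with the root labels imposed, the conditional squared deviations depend on
  -- the labels of disjoint blocks.
  refine integral_labelLaw_le_of_update i j _ _ fun a b => ?_
  change ∫ z, ∏ l, (1 + c * sqDev G (rootedEmbeddings v₁ v₂ i j (J l)) p q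
    (if relabel i j a b z i = relabel i j a b z j then T else 0) (relabel i j a b z))
      ∂labelLaw n K ≤ _
  have hnn' : ∀ z l, 0 ≤ 1 + c * sqDev G (rootedEmbeddings v₁ v₂ i j (J l)) p q
      (if a = b then T else 0) (relabel i j a b z) := by
    intro z l
    have := hnn (relabel i j a b z) l
    rwa [relabel_left hij, relabel_right] at this
  simp_rw [relabel_left hij, relabel_right]
  unfold labelLaw
  rw [integral_pi_prod_of_dependsOn _ J (fun l l' h => hdisj l l' h)]
  · calc _ ≤ ∏ _l : Fin L, (2 : ℝ) := by
          refine Finset.prod_le_prod (fun l _ => integral_nonneg fun z => hnn' z l) fun l _ => ?_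
          rw [integral_add Integrable.of_finite Integrable.of_finite, integral_const,
            probReal_univ, one_smul, integral_const_mul]
          have := hdev l a b
          unfold labelLaw at this
          linarith
      _ = 2 ^ L := by simp
  · intro l z z' h
    have := dependsOn_sqDev (G := G) (v₁ := v₁) (v₂ := v₂) hij (J l) p q
      (if a = b then T else 0) a b h
    dsimp only at this ⊢
    rw [this]

/-- The probability that at least half of the blocks have a count far from its mean. -/
theorem IsBalancedMotif.sbm_real_majority_bad_le [NeZero K] (hG : IsBalancedMotif G v₁ v₂ r)
    {p q : ℝ} (hq : 0 ≤ q) (hqp : q ≤ p) (hp : p ≤ 1) {i j : Fin n} (hij : i ≠ j)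
    (J : Fin L → Finset (Fin n)) (hdisj : ∀ l l', l ≠ l' → Disjoint (J l) (J l')) {T : ℝ}
    (hT : 0 < T)
    (hdev : ∀ l a b, 60 * ∫ z, sqDev G (rootedEmbeddings v₁ v₂ i j (J l)) p q
      (if a = b then T else 0) (relabel i j a b z) ∂labelLaw n K ≤ T ^ 2) :
    (sbm n K p q).real {ω | L ≤ 2 * (Finset.univ.filter fun l =>
      T / 2 ≤ |motifCount G v₁ v₂ q ω.2 i j (J l) - if ω.1 i = ω.1 j then T else 0|).card} ≤
      (1 / 2) ^ L := by
  have hT2 : 0 < T ^ 2 := by positivity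
  have hint := hG.integral_prod_blocks_le hq hqp hp hij J hdisj T (60 / T ^ 2) (by positivity)
    (fun l a b => by
      rw [div_mul_eq_mul_div, div_le_one hT2]
      exact hdev l a b)
  rw [sbm_real_eq]
  have hpt : ∀ z : Fin n → Fin K, (graphKernel n K p q z).real {y | (z, y) ∈
      {ω : SBMSample n K | L ≤ 2 * (Finset.univ.filter fun l => T / 2 ≤
        |motifCount G v₁ v₂ q ω.2 i j (J l) - if ω.1 i = ω.1 j then T else 0|).card}} ≤
      (1 / 4) ^ L * ∫ y, ∏ l, (1 + 60 / T ^ 2 * (motifCount G v₁ v₂ q y i j (J l) -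
        if z i = z j then T else 0) ^ 2) ∂graphKernel n K p q z := by
    intro z
    rw [← integral_const_mul, ← integral_indicator_one (Set.toFinite _).measurableSet]
    refine integral_mono Integrable.of_finite Integrable.of_finite fun y => ?_
    set ρ : ℝ := if z i = z j then T else 0 with hρ
    have h1 : ∀ l, (1 : ℝ) ≤ 1 + 60 / T ^ 2 * (motifCount G v₁ v₂ q y i j (J l) - ρ) ^ 2 := by
      intro l
      have : 0 ≤ 60 / T ^ 2 * (motifCount G v₁ v₂ q y i j (J l) - ρ) ^ 2 := by positivity
      linarith
    -- A bad block contributes 1 + 60/4 = 16, so a bad majority makes the product at least 16^(L/2)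
    -- = 4^L, against a mean of at most 2^L.
    have h2 : ∀ l, T / 2 ≤ |motifCount G v₁ v₂ q y i j (J l) - ρ| →
        (16 : ℝ) ≤ 1 + 60 / T ^ 2 * (motifCount G v₁ v₂ q y i j (J l) - ρ) ^ 2 := by
      intro l hl
      have h3 : (T / 2) ^ 2 ≤ (motifCount G v₁ v₂ q y i j (J l) - ρ) ^ 2 := by
        rw [← sq_abs (motifCount G v₁ v₂ q y i j (J l) - ρ)]
        exact pow_le_pow_left₀ (by positivity) hl 2
      have h4 : 60 / T ^ 2 * (T / 2) ^ 2 ≤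
          60 / T ^ 2 * (motifCount G v₁ v₂ q y i j (J l) - ρ) ^ 2 := by gcongr
      have h5 : 60 / T ^ 2 * (T / 2) ^ 2 = 15 := by field_simp; norm_num
      linarith
    rw [Set.indicator_apply]
    split_ifs with hy
    · simp only [Set.mem_ofPred_eq] at hy
      set S := Finset.univ.filter fun l => T / 2 ≤ |motifCount G v₁ v₂ q y i j (J l) - ρ| with hS
      have h3 : (16 : ℝ) ^ S.card ≤
          ∏ l, (1 + 60 / T ^ 2 * (motifCount G v₁ v₂ q y i j (J l) - ρ) ^ 2) := by
        calc (16 : ℝ) ^ S.card = ∏ l, if l ∈ S then (16 : ℝ) else 1 := by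
              rw [Finset.prod_ite_mem, Finset.univ_inter, Finset.prod_const]
          _ ≤ _ := by
            refine Finset.prod_le_prod (fun l _ => by split_ifs <;> norm_num) fun l _ => ?_
            split_ifs with hl
            · exact h2 l (Finset.mem_filter.1 hl).2
            · exact h1 l
      have h4 : (4 : ℝ) ^ L ≤ 16 ^ S.card := by
        calc (4 : ℝ) ^ L ≤ 4 ^ (2 * S.card) := pow_le_pow_right₀ (by norm_num) hy
          _ = _ := by rw [pow_mul]; norm_num
      have h5 : (1 / 4 : ℝ) ^ L * 4 ^ L = 1 := by rw [← mul_pow]; norm_num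
      refine h5.symm.le.trans ?_
      exact mul_le_mul_of_nonneg_left (h4.trans h3) (by positivity)
    · refine mul_nonneg (by positivity) (Finset.prod_nonneg fun l _ => ?_)
      linarith [h1 l]
  refine (integral_mono Integrable.of_finite Integrable.of_finite hpt).trans ?_
  rw [integral_const_mul]
  calc (1 / 4 : ℝ) ^ L * _ ≤ (1 / 4) ^ L * 2 ^ L :=
        mul_le_mul_of_nonneg_left hint (by positivity)
    _ = (1 / 2) ^ L := by rw [← mul_pow]; norm_num

/-- If the median lies on the wrong side of T/2, then so do at least half of the values, and each of
these is at distance at least T/2 from its target. -/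
theorem IsMedian.lt_iff_of_not_majority_bad {u : Fin L → ℝ} {M T : ℝ} (hM : IsMedian u M)
    (P : Prop) [Decidable P]
    (h : ¬ L ≤ 2 * (Finset.univ.filter fun l => T / 2 ≤ |u l - if P then T else 0|).card) :
    T / 2 < M ↔ P := by
  have hle : ∀ Q : Fin L → Prop, (∀ l, Q l → T / 2 ≤ |u l - if P then T else 0|) →
      ¬ L ≤ 2 * Nat.card {l // Q l} := by
    intro Q hQ hL
    apply h
    rw [Nat.card_eq_fintype_card, Fintype.card_subtype] at hL
    refine hL.trans (Nat.mul_le_mul_left 2 (Finset.card_le_card fun l hl => ?_))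
    exact Finset.mem_filter.2 ⟨Finset.mem_univ _, hQ l (Finset.mem_filter.1 hl).2⟩
  constructor
  · intro hlt
    by_contra hP
    refine hle _ (fun l hl => ?_) hM.2
    rw [if_neg hP, sub_zero]
    exact (hlt.le.trans hl).trans (le_abs_self _)
  · intro hP
    by_contra hlt
    refine hle _ (fun l hl => ?_) hM.1
    rw [if_pos hP]
    have : T / 2 ≤ T - u l := by linarith
    rw [abs_sub_comm]
    exact this.trans (le_abs_self _)

end Blocks

/-! ### Signal strength, constants, and the failure probability of one pair -/

section Recovery

open Classical

/-- The signal condition in terms of `λ ^ r`. -/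
theorem signal_lower_bound {n K : ℕ} {r lam qb W : ℝ} (hr : 0 < r) (hK : 2 ≤ K) (hKn : K ≤ n)
    (hlam : 0 < lam) (hqb : qb = (n : ℝ) ^ (-1 / r)) (hW : 0 < W)
    (h : W ^ (1 / r) * Real.log n ^ (1 / r) * (lam / K + qb) ^ (1 - Real.logb n K) ≤ lam) :
    W * Real.log n * K / n ≤ lam ^ r := by
  have hn2 : (2 : ℝ) ≤ n := by exact_mod_cast hK.trans hKn
  have hn : (0 : ℝ) < n := by linarith
  have hK0 : (0 : ℝ) < K := by
    have : (2 : ℝ) ≤ K := by exact_mod_cast hK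
    linarith
  have hlog : 0 < Real.log n := Real.log_pos (by linarith)
  have hqb0 : 0 < qb := by rw [hqb]; positivity
  have he : 0 ≤ 1 - Real.logb n K := by
    rw [sub_nonneg, Real.logb_le_iff_le_rpow (by linarith) hK0, Real.rpow_one]
    exact_mod_cast hKn
  have h1 : qb ^ (1 - Real.logb n K) ≤ (lam / K + qb) ^ (1 - Real.logb n K) :=
    Real.rpow_le_rpow hqb0.le (by have := div_pos hlam hK0; linarith) he
  have h2 : W ^ (1 / r) * Real.log n ^ (1 / r) * qb ^ (1 - Real.logb n K) ≤ lam :=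
    (mul_le_mul_of_nonneg_left h1 (by positivity)).trans h
  have h3 := Real.rpow_le_rpow (by positivity) h2 hr.le
  rw [Real.mul_rpow (by positivity) (by positivity), Real.mul_rpow (by positivity) (by positivity),
    ← Real.rpow_mul hW.le, ← Real.rpow_mul hlog.le, one_div_mul_cancel hr.ne', Real.rpow_one,
    Real.rpow_one] at h3
  -- The exponent 1 - log_n K is tuned for this: the r-th power of q̄ is 1/n, and n^(log_n K) = K.
  have h4 : (qb ^ (1 - Real.logb n K)) ^ r = K / n := by
    rw [hqb, ← Real.rpow_mul hn.le, ← Real.rpow_mul hn.le]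
    have : -1 / r * (1 - Real.logb n K) * r = Real.logb n K - 1 := by field_simp; ring
    rw [this, Real.rpow_sub hn, Real.rpow_one, Real.rpow_logb hn (by linarith) hK0]
  rw [h4] at h3
  calc W * Real.log n * K / n = W * Real.log n * (K / n) := by ring
    _ ≤ _ := h3

theorem half_le_log {n : ℕ} (hn : 2 ≤ n) : (1 : ℝ) / 2 ≤ Real.log n := by
  have h1 : Real.log 2 ≤ Real.log n := Real.log_le_log (by norm_num) (by exact_mod_cast hn)
  have := Real.log_two_gt_d9
  linarith

/-- As log n ≥ 1/2, there are at most 26 log n blocks. Using n - 2 ≥ n/2 and then absorbing the loss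
of 1 from the integer division each costs a factor 2, so 104 = 4 · 26. -/
theorem le_blockSize {n : ℕ} (hn : 4 ≤ n) (h : 104 * Real.log n ≤ n) :
    (n : ℝ) / (104 * Real.log n) ≤ blockSize n := by
  have hlog := half_le_log (n := n) (by omega)
  have hL : ((numBlocks n : ℕ) : ℝ) ≤ 26 * Real.log n := by
    have := Nat.ceil_lt_add_one (a := 24 * Real.log n) (by linarith)
    unfold numBlocks
    linarith
  have hL0 : 0 < numBlocks n := Nat.ceil_pos.2 (by linarith)
  have hL0' : (0 : ℝ) < numBlocks n := by exact_mod_cast hL0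
  have hdiv : n - 2 < numBlocks n * (blockSize n + 1) := by
    unfold blockSize
    exact Nat.lt_mul_div_succ (n - 2) hL0
  have hdiv' : (n : ℝ) - 2 < numBlocks n * (blockSize n + 1) := by
    have h2 : ((n - 2 : ℕ) : ℝ) < ((numBlocks n * (blockSize n + 1) : ℕ) : ℝ) := by
      exact_mod_cast hdiv
    rw [Nat.cast_sub (by omega)] at h2
    push_cast at h2
    exact h2
  have hn' : (4 : ℝ) ≤ n := by exact_mod_cast hn
  have h3 : (n : ℝ) / 2 ≤ 26 * Real.log n * (blockSize n + 1) := by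
    have : (numBlocks n : ℝ) * (blockSize n + 1) ≤ 26 * Real.log n * (blockSize n + 1) := by
      gcongr
    linarith
  have hpos : 0 < 104 * Real.log n := by linarith
  rw [div_le_iff₀ hpos]
  nlinarith

theorem half_pow_numBlocks_le {n : ℕ} (hn : 2 ≤ n) : (1 / 2 : ℝ) ^ numBlocks n ≤ 1 / (n : ℝ) ^ 3 := by
  have hn0 : (0 : ℝ) < n := by
    have : 0 < n := by omega
    exact_mod_cast this
  have hlog := half_le_log hn
  rw [one_div, inv_pow, one_div]
  refine inv_anti₀ (by positivity) ?_
  rw [← Real.log_le_log_iff (by positivity) (by positivity), Real.log_pow, Real.log_pow]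
  have h1 : 24 * Real.log n ≤ numBlocks n := Nat.le_ceil _
  have h2 := Real.log_two_gt_d9
  push_cast
  nlinarith

theorem recovers_of_forall_lt {n K : ℕ} {xhat : Fin n → Fin n → ℝ} {z : Fin n → Fin K}
    (h : ∀ i j, i < j → xhat i j = membership z i j) : Recovers xhat z := by
  refine ⟨h, ?_⟩
  have hadj : ∀ i j, i < j → (xhat i j = 1 - 1 / (K : ℝ) ↔ z i = z j) := by
    intro i j hij
    rw [h i j hij, membership]
    split_ifs with hz
    · simp [hz]
    · refine iff_of_false (fun h' => ?_) hz
      linarith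
  intro i j
  constructor
  · rintro ⟨w⟩
    induction w with
    | nil => rfl
    | cons hab _ ih =>
      refine Eq.trans ?_ ih
      simp only [estimatedGraph, SimpleGraph.fromRel_adj] at hab
      rcases hab.2 with h' | h'
      · exact (hadj _ _ h'.1).1 h'.2
      · exact ((hadj _ _ h'.1).1 h'.2).symm
  · intro hz
    rcases lt_trichotomy i j with hij | hij | hij
    · exact SimpleGraph.Adj.reachable ((SimpleGraph.fromRel_adj _ _ _).2
        ⟨hij.ne, Or.inl ⟨hij, (hadj i j hij).2 hz⟩⟩)
    · rw [hij]
    · exact SimpleGraph.Adj.reachable ((SimpleGraph.fromRel_adj _ _ _).2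
        ⟨hij.ne', Or.inr ⟨hij, (hadj j i hij).2 hz.symm⟩⟩)

/-- Since Θ ≤ 1, the signal condition forces n ≥ W K log n, so the blocks are large when W is. -/
theorem le_blockSize_of_signal {n K : ℕ} {W Θ : ℝ} (hK : 2 ≤ K) (hKn : K ≤ n) (hW : 212 ≤ W)
    (hΘ : Θ ≤ 1) (hsignal : W * Real.log n * K / n ≤ Θ) :
    (n : ℝ) / (104 * Real.log n) ≤ blockSize n ∧ W / 104 ≤ blockSize n := by
  have hK2 : (2 : ℝ) ≤ K := by exact_mod_cast hK
  have hn2 : 2 ≤ n := hK.trans hKn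
  have hn2' : (2 : ℝ) ≤ n := by exact_mod_cast hn2
  have hn0 : (0 : ℝ) < n := by linarith
  have hlog := half_le_log hn2
  have hsig : W * Real.log n * K ≤ n := by
    have := (div_le_iff₀ hn0).1 (hsignal.trans hΘ)
    linarith
  have hWl1 : 106 ≤ W * Real.log n := by nlinarith
  have hWl : W * Real.log n ≤ n := by nlinarith
  have hn4 : 4 ≤ n := by
    have : (4 : ℝ) ≤ n := by linarith
    exact_mod_cast this
  have hB := le_blockSize hn4 (by nlinarith)
  refine ⟨hB, le_trans ?_ hB⟩
  rw [div_le_div_iff₀ (by norm_num) (by linarith)]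
  nlinarith

/-- The constant of the signal condition, raised to the power `r`. -/
noncomputable def signalConst (E D : ℕ) : ℝ :=
  6240 * momentConst E D * 4 ^ D * D + 208 * D + 4

/-- With 6240 = 60 · 104, the first bound makes the relative squared deviation at most 1/60. The
second, with 208 = 2 · 104, makes blocks of size at least 2D and ε at most 1. The third handles
small n. -/
theorem signalConst_bounds (E : ℕ) {D : ℕ} (hD : 0 < D) :
    6240 * (momentConst E D * 4 ^ D * D) ≤ signalConst E D ∧ 208 * (D : ℝ) ≤ signalConst E D ∧
      212 ≤ signalConst E D := by
  have hD1 : (1 : ℝ) ≤ D := by exact_mod_cast hD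
  have h : 0 < momentConst E D * 4 ^ D * D := by
    have := momentConst_pos E D
    positivity
  have hW : signalConst E D = 6240 * momentConst E D * 4 ^ D * D + 208 * D + 4 := rfl
  refine ⟨?_, ?_, ?_⟩ <;> linarith

variable {V : Type} [Fintype V] {G : SimpleGraph V} {v₁ v₂ : V} {r : ℝ} {n K : ℕ}

theorem IsBalancedMotif.sbm_real_bad_pair_le [NeZero K] (hG : IsBalancedMotif G v₁ v₂ r)
    (hr : 0 < r) (hv : v₁ ≠ v₂) (hD : 0 < Fintype.card V - 2) {p q : ℝ} (hK : 2 ≤ K)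
    (hKn : K ≤ n) (hq : 0 < q) (hqp : q < p) (hp : p < 1)
    (hqb : q * (1 - q) = (n : ℝ) ^ (-1 / r)) (hlam : p - q ≤ 1 - 2 * q)
    (hsignal : signalConst G.edgeFinset.card (Fintype.card V - 2) * Real.log n * K / n ≤
      (p - q) ^ r) {i j : Fin n} (hij : i ≠ j) {J : Fin (numBlocks n) → Finset (Fin n)}
    (hJ : IsBlockFamily i j J) :
    (sbm n K p q).real {ω | numBlocks n ≤ 2 * (Finset.univ.filter fun l =>
      ((blockSize n).descFactorial (Fintype.card V - 2) *
        ((p - q) ^ r / K) ^ (Fintype.card V - 2) : ℝ) / 2 ≤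
          |motifCount G v₁ v₂ q ω.2 i j (J l) - if ω.1 i = ω.1 j then
            ((blockSize n).descFactorial (Fintype.card V - 2) *
              ((p - q) ^ r / K) ^ (Fintype.card V - 2) : ℝ) else 0|).card} ≤
      1 / (n : ℝ) ^ 3 := by
  have hl : 0 < p - q := by linarith
  have hΘ : 0 < (p - q) ^ r := Real.rpow_pos_of_pos hl r
  have hK2 : (2 : ℝ) ≤ K := by exact_mod_cast hK
  have hn2 : 2 ≤ n := hK.trans hKn
  have hn2' : (2 : ℝ) ≤ n := by exact_mod_cast hn2
  have hn0 : (0 : ℝ) < n := by linarith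
  have hlog := half_le_log hn2
  have hlog0 : 0 < Real.log n := by linarith
  have hC := momentConst_pos G.edgeFinset.card (Fintype.card V - 2)
  have hqb0 : 0 < q * (1 - q) := mul_pos hq (by linarith)
  have hqbr : (q * (1 - q)) ^ r = 1 / n := by
    rw [hqb, ← Real.rpow_mul hn0.le, div_mul_cancel₀ _ hr.ne', Real.rpow_neg_one, one_div]
  have hD1 : (1 : ℝ) ≤ (Fintype.card V - 2 : ℕ) := by exact_mod_cast hD
  refine le_trans ?_ (half_pow_numBlocks_le hn2)
  have hmain := hG.integral_sqDev_le hr.le hv hq hqp hp hlam (n := n) (K := K)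
  have hbad := hG.sbm_real_majority_bad_le (K := K) hq.le hqp.le hp.le hij J hJ.2
    (T := (blockSize n).descFactorial (Fintype.card V - 2) *
        ((p - q) ^ r / K) ^ (Fintype.card V - 2))
  have hΘ1 : (p - q) ^ r ≤ 1 := Real.rpow_le_one hl.le (by linarith) hr.le
  set D := Fintype.card V - 2 with hDdef
  set C := momentConst G.edgeFinset.card D with hCdef
  set W := signalConst G.edgeFinset.card D with hWdef
  have hCD : 0 < C * 4 ^ D * D := by positivity
  obtain ⟨hW1, hW2, hW3⟩ := signalConst_bounds G.edgeFinset.card hD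
  rw [← hWdef] at hW1 hW2 hW3
  rw [← hCdef] at hW1
  have hsig : W * Real.log n * K ≤ (p - q) ^ r * n := (div_le_iff₀ hn0).1 hsignal
  clear_value C W
  have hWl1 : 106 ≤ W * Real.log n := by nlinarith
  obtain ⟨hB, hBlow⟩ := le_blockSize_of_signal hK hKn hW3 hΘ1 hsignal
  have hB2 : 2 * D ≤ blockSize n := by
    have : ((2 * D : ℕ) : ℝ) ≤ blockSize n := by push_cast; linarith
    exact_mod_cast this
  have hB0 : (0 : ℝ) < blockSize n := by linarith
  -- Compare r-th powers: that of q̄ is 1/n, which the signal condition places below λ^r.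
  have hql : q * (1 - q) ≤ p - q := by
    rw [← Real.rpow_le_rpow_iff hqb0.le hl.le hr, hqbr, div_le_iff₀ hn0]
    have : W * Real.log n * 1 ≤ W * Real.log n * K := by gcongr; linarith
    linarith
  have hKx : K * (q * (1 - q) / (p - q)) ^ r ≤ 1 := by
    rw [Real.div_rpow hqb0.le hl.le, hqbr, div_div, mul_one_div, div_le_one (by positivity)]
    have : 1 * (K : ℝ) ≤ W * Real.log n * K := by gcongr; linarith
    linarith
  have hε : (D : ℝ) * K / ((p - q) ^ r * blockSize n) ≤ 104 * D / W := by
    rw [div_le_div_iff₀ (by positivity) (by linarith)]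
    rw [div_le_iff₀ (by positivity)] at hB
    have h1 : W * Real.log n * K ≤ (p - q) ^ r * (blockSize n * (104 * Real.log n)) :=
      hsig.trans (by gcongr)
    have h2 : W * K * Real.log n ≤ (p - q) ^ r * blockSize n * 104 * Real.log n := by
      linarith
    have h3 : W * K ≤ (p - q) ^ r * blockSize n * 104 := le_of_mul_le_mul_right h2 hlog0
    calc (D : ℝ) * K * W = D * (W * K) := by ring
      _ ≤ D * ((p - q) ^ r * blockSize n * 104) := by gcongr
      _ = _ := by ring
  have hε1 : 104 * (D : ℝ) / W ≤ 1 := (div_le_one (by linarith)).2 (by linarith)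
  have hε2 : 60 * (C * 4 ^ D * (104 * (D : ℝ) / W)) ≤ 1 := by
    have : 60 * (C * 4 ^ D * (104 * (D : ℝ) / W)) = 6240 * (C * 4 ^ D * D) / W := by ring
    rw [this]
    exact (div_le_one (by linarith)).2 hW1
  have hdesc : (0 : ℝ) < (blockSize n).descFactorial D := by
    have : 0 < (blockSize n).descFactorial D := Nat.descFactorial_pos.2 (by omega)
    exact_mod_cast this
  refine hbad (by positivity) fun l a b => ?_
  have h1 := hmain hql hij (J := J l) (hJ.1 l).1 (hJ.1 l).2.1 hKx a b hD
  rw [(hJ.1 l).2.2] at h1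
  have h2 := h1 hB2 (hε.trans hε1)
  have hT : 0 ≤ ((blockSize n).descFactorial D * ((p - q) ^ r / K) ^ D : ℝ) ^ 2 := by positivity
  have h3 : C * 4 ^ D * ((D : ℝ) * K / ((p - q) ^ r * blockSize n)) ≤
      C * 4 ^ D * (104 * (D : ℝ) / W) := by gcongr
  have h4 := mul_le_mul_of_nonneg_left h3 hT
  have h5 := mul_le_mul_of_nonneg_left hε2 hT
  linarith

end Recovery

/-! ### Isoperimetry in the cyclic blow-up -/

section Cycle

variable {m : ℕ} [NeZero m]

theorem Fin.val_add_one_mod (ω : Fin m) : (ω + 1).val = (ω.val + 1) % m := by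
  rw [Fin.val_add, Fin.val_one', Nat.add_mod_mod]

/-- A property of the layers that passes to the cyclically next layer holds for all layers. -/
theorem Fin.forall_of_cyclic {P : Fin m → Prop} (hP : ∀ ω, P ω → P (ω + 1)) {ω₀ : Fin m}
    (h₀ : P ω₀) (ω : Fin m) : P ω := by
  have hm : 0 < m := NeZero.pos m
  have h : ∀ j : ℕ, P ⟨(ω₀.val + j) % m, Nat.mod_lt _ hm⟩ := by
    intro j
    induction j with
    | zero => simpa [Nat.mod_eq_of_lt ω₀.2] using h₀
    | succ j ih =>
      have := hP _ ih
      convert this using 1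
      ext
      rw [Fin.val_add_one_mod]
      simp [add_assoc]
  have := h (m - ω₀.val + ω.val)
  convert this using 1
  ext
  have hω := ω₀.2
  have : ω₀.val + (m - ω₀.val + ω.val) = ω.val + m := by omega
  simp only [this, Nat.add_mod_right, Nat.mod_eq_of_lt ω.2]

theorem sum_cyclic_shift (g : Fin m → ℝ) : ∑ ω, g (ω + 1) = ∑ ω, g ω :=
  Equiv.sum_comp (Equiv.addRight 1) g

/-- Half of the boundary, within the cyclic blow-up, of a set with `t ω` nodes in the layer `ω`. -/
def halfBoundary (k : ℕ) (t : Fin m → ℕ) : ℝ := ∑ ω, (t ω : ℝ) * (k - t (ω + 1))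

/-- A full layer followed by a non-full one, or a nonempty layer followed by an empty one, already
gives k. Otherwise all layers are strictly between empty and full, and each of the m ≥ k terms is at
least 1. -/
theorem le_halfBoundary {k : ℕ} {t : Fin m → ℕ} (hkm : k ≤ m) (htk : ∀ ω, t ω ≤ k)
    {ω₀ ω₁ : Fin m} (h₀ : t ω₀ ≠ 0) (h₁ : t ω₁ ≠ k) : (k : ℝ) ≤ halfBoundary k t := by
  have hnn : ∀ ω, 0 ≤ (t ω : ℝ) * (k - t (ω + 1)) := by
    intro ω
    have : (t (ω + 1) : ℝ) ≤ k := by exact_mod_cast htk _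
    exact mul_nonneg (Nat.cast_nonneg _) (by linarith)
  have hsingle : ∀ ω, (t ω : ℝ) * (k - t (ω + 1)) ≤ halfBoundary k t := fun ω =>
    Finset.single_le_sum (fun ω _ => hnn ω) (Finset.mem_univ ω)
  by_cases hfull : ∃ ω, t ω = k
  · obtain ⟨ω₂, h₂⟩ := hfull
    obtain ⟨ω, hω, hω'⟩ : ∃ ω, t ω = k ∧ t (ω + 1) ≠ k := by
      by_contra! hcon
      exact h₁ (Fin.forall_of_cyclic (P := fun ω => t ω = k) hcon h₂ ω₁)
    have hlt : (t (ω + 1) : ℝ) + 1 ≤ k := by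
      have := htk (ω + 1)
      have : t (ω + 1) + 1 ≤ k := by omega
      exact_mod_cast this
    refine le_trans ?_ (hsingle ω)
    rw [hω]
    exact le_mul_of_one_le_right (Nat.cast_nonneg _) (by linarith)
  · push Not at hfull
    by_cases hzero : ∃ ω, t ω = 0
    · obtain ⟨ω₂, h₂⟩ := hzero
      obtain ⟨ω, hω, hω'⟩ : ∃ ω, t ω ≠ 0 ∧ t (ω + 1) = 0 := by
        by_contra! hcon
        exact Fin.forall_of_cyclic (P := fun ω => t ω ≠ 0) hcon h₀ ω₂ h₂
      refine le_trans ?_ (hsingle ω)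
      rw [hω', Nat.cast_zero, sub_zero]
      refine le_mul_of_one_le_left (Nat.cast_nonneg _) ?_
      exact_mod_cast Nat.one_le_iff_ne_zero.2 hω
    · push Not at hzero
      have hone : ∀ ω, (1 : ℝ) ≤ (t ω : ℝ) * (k - t (ω + 1)) := by
        intro ω
        have h1 : (1 : ℝ) ≤ t ω := by exact_mod_cast Nat.one_le_iff_ne_zero.2 (hzero ω)
        have h2 : (t (ω + 1) : ℝ) + 1 ≤ k := by
          have h3 := htk (ω + 1)
          have h4 := hfull (ω + 1)
          have : t (ω + 1) + 1 ≤ k := by omega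
          exact_mod_cast this
        nlinarith
      calc (k : ℝ) ≤ m := by exact_mod_cast hkm
        _ = ∑ _ω : Fin m, (1 : ℝ) := by simp
        _ ≤ _ := Finset.sum_le_sum fun ω _ => hone ω

/-- The fasteners of a set and half of its cyclic boundary outweigh its size. -/
theorem mul_sum_le_halfBoundary_add {k : ℕ} {a : ℝ} (ha1 : a ≤ 1) {w : Fin m → ℕ}
    (hwk : ∀ ω, w ω ≤ k) {s φ f : Fin m → ℝ} (hφ0 : ∀ ω, 0 ≤ φ ω) (hφ1 : ∀ ω, φ ω ≤ 1)
    (hs : ∀ ω, s ω = a * k + φ ω - φ (ω + 1)) (hf : ∀ ω, 0 ≤ f ω)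
    (hfs : ∀ ω, s ω + w ω - k ≤ f ω) :
    a * ∑ ω, (w ω : ℝ) ≤ halfBoundary k w + ∑ ω, f ω := by
  set full : Fin m → ℝ := fun ω => if w ω = k then 1 else 0 with hfull
  -- A non-full layer has w(k - w) ≥ w ≥ aw. A full layer cuts all its fasteners, which differ from
  -- ak by the rounding error φ(ω) - φ(ω+1).
  have h1 : ∀ ω, 0 ≤ (w ω : ℝ) * (k - w ω) - a * w ω + f ω - full ω * (s ω - a * k) := by
    intro ω
    have hw0 : (0 : ℝ) ≤ w ω := Nat.cast_nonneg _
    by_cases h : w ω = k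
    · have := hfs ω
      simp only [hfull, h, if_true] at this ⊢
      linarith
    · have : w ω + 1 ≤ k := by have := hwk ω; omega
      have : (w ω : ℝ) + 1 ≤ k := by exact_mod_cast this
      have h3 := hf ω
      simp only [hfull, h, if_false]
      nlinarith
  -- After summation by parts the rounding errors survive only where fullness changes. Centring φ at
  -- 1/2 limits each to 1/2, and the squared jump there is at least 1.
  have h2 : ∀ ω, 0 ≤ ((w ω : ℝ) - w (ω + 1)) ^ 2 / 2 +
      (φ (ω + 1) - 1 / 2) * (full (ω + 1) - full ω) := by
    intro ω
    have hφ0' := hφ0 (ω + 1)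
    have hφ1' := hφ1 (ω + 1)
    have hne : w ω ≠ w (ω + 1) → (1 : ℝ) ≤ ((w ω : ℝ) - w (ω + 1)) ^ 2 := by
      intro hne
      have : (1 : ℤ) ≤ ((w ω : ℤ) - w (ω + 1)) ^ 2 := by
        have : ((w ω : ℤ) - w (ω + 1)) ≠ 0 := by omega
        have := sq_pos_of_ne_zero this
        omega
      exact_mod_cast this
    have hsq := sq_nonneg ((w ω : ℝ) - w (ω + 1))
    by_cases h : w ω = k <;> by_cases h' : w (ω + 1) = k
    · simp only [hfull, h, h', if_true]; linarith
    · have := hne (by rw [h]; exact fun h => h' h.symm)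
      simp only [hfull, if_pos h, if_neg h']; linarith
    · have := hne (by rw [h']; exact h)
      simp only [hfull, if_neg h, if_pos h']; linarith
    · simp only [hfull, if_neg h, if_neg h']; linarith
  have h3 := Finset.sum_nonneg fun ω (_ : ω ∈ Finset.univ) => add_nonneg (h1 ω) (h2 ω)
  have hsq := sum_cyclic_shift fun ω => (w ω : ℝ) ^ 2
  have hIs := sum_cyclic_shift full
  have hIφ := sum_cyclic_shift fun ω => full ω * φ ω
  -- The forward boundary is Σ w(k - w) plus half the sum of squared jumps; the remaining
  -- discrepancies telescope around the cycle.
  have h4 : ∀ ω, (w ω : ℝ) * (k - w ω) - a * w ω + f ω - full ω * (s ω - a * k) +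
      (((w ω : ℝ) - w (ω + 1)) ^ 2 / 2 + (φ (ω + 1) - 1 / 2) * (full (ω + 1) - full ω)) =
      (w ω : ℝ) * (k - w (ω + 1)) + f ω - a * w ω + 1 / 2 * (w (ω + 1) : ℝ) ^ 2 -
        1 / 2 * (w ω : ℝ) ^ 2 + full (ω + 1) * φ (ω + 1) - full ω * φ ω - 1 / 2 * full (ω + 1) +
        1 / 2 * full ω := by
    intro ω
    rw [hs ω]; ring
  simp_rw [h4, Finset.sum_add_distrib, Finset.sum_sub_distrib, Finset.sum_add_distrib,
    Finset.sum_sub_distrib, Finset.sum_add_distrib, ← Finset.mul_sum] at h3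
  rw [Finset.sum_sub_distrib, Finset.sum_add_distrib, ← Finset.mul_sum] at h3
  unfold halfBoundary
  linarith

end Cycle

/-! ### Counting fastener nodes and their rounding errors -/

section Fasteners

theorem floor_fastener (k α β ω : ℕ) : ⌊((α : ℚ) / β) * ω * k⌋₊ = α * ω * k / β := by
  rw [show ((α : ℚ) / β) * ω * k = ((α * ω * k : ℕ) : ℚ) / (β : ℕ) by push_cast; ring]
  exact Nat.floor_div_eq_div _ _

theorem sum_fastenerCount (k α β ω : ℕ) :
    ∑ i : Fin ω, fastenerCount k ((α : ℚ) / β) i = α * ω * k / β := by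
  induction ω with
  | zero => simp
  | succ ω ih =>
    rw [Fin.sum_univ_castSucc]
    simp only [Fin.val_castSucc, Fin.val_last]
    rw [fastenerCount, ih]
    have h := floor_fastener k α β (ω + 1)
    push_cast at h
    rw [h]
    have : α * ω * k / β ≤ α * (ω + 1) * k / β :=
      Nat.div_le_div_right (by gcongr; omega)
    omega

theorem fastenerCount_eq (k α β ω : ℕ) :
    fastenerCount k ((α : ℚ) / β) ω = α * (ω + 1) * k / β - α * ω * k / β := by
  have h1 := sum_fastenerCount k α β (ω + 1)
  rw [Fin.sum_univ_castSucc] at h1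
  simp only [Fin.val_castSucc, Fin.val_last] at h1
  rw [sum_fastenerCount] at h1
  omega

theorem fastenerCount_le {k α β : ℕ} (hβ : 0 < β) (h : α ≤ β) (ω : ℕ) :
    fastenerCount k ((α : ℚ) / β) ω ≤ k := by
  rw [fastenerCount_eq, Nat.sub_le_iff_le_add, Nat.add_comm k, ← Nat.add_mul_div_left _ _ hβ]
  refine Nat.div_le_div_right ?_
  nlinarith [Nat.mul_le_mul_right k h]

/-- The fractional part of `a ω k`. -/
noncomputable def fastenerFract (k α β ω : ℕ) : ℝ := (α : ℝ) / β * ω * k - (α * ω * k / β : ℕ)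

theorem fastenerFract_nonneg (k α β ω : ℕ) : 0 ≤ fastenerFract k α β ω := by
  unfold fastenerFract
  have : ((α * ω * k / β : ℕ) : ℝ) ≤ ((α * ω * k : ℕ) : ℝ) / β := Nat.cast_div_le
  push_cast at this
  have h : (α : ℝ) / β * ω * k = α * ω * k / β := by ring
  rw [h]; linarith

theorem fastenerFract_le_one {β : ℕ} (hβ : 0 < β) (k α ω : ℕ) : fastenerFract k α β ω ≤ 1 := by
  unfold fastenerFract
  have h := Nat.lt_mul_div_succ (α * ω * k) hβ
  have h' : (α : ℝ) * ω * k < β * ((α * ω * k / β : ℕ) + 1) := by exact_mod_cast h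
  have hβ' : (0 : ℝ) < β := by exact_mod_cast hβ
  have h2 : (α : ℝ) / β * ω * k = α * ω * k / β := by ring
  rw [h2, sub_le_iff_le_add, div_le_iff₀ hβ']
  linarith

/-- The choice m = 2βk makes amk an integer, so the rounding errors close up around the cycle. -/
theorem fastenerFract_period {k α β : ℕ} (hβ : 0 < β) :
    fastenerFract k α β (2 * β * k) = 0 := by
  unfold fastenerFract
  have : α * (2 * β * k) * k / β = α * 2 * k * k := by
    rw [show α * (2 * β * k) * k = β * (α * 2 * k * k) by ring, Nat.mul_div_cancel_left _ hβ]
  rw [this]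
  have hβ' : (β : ℝ) ≠ 0 := by positivity
  push_cast
  field_simp
  ring

theorem fastenerCount_eq_fract (k α β ω : ℕ) :
    (fastenerCount k ((α : ℚ) / β) ω : ℝ) =
      (α : ℝ) / β * k + fastenerFract k α β ω - fastenerFract k α β (ω + 1) := by
  rw [fastenerCount_eq, Nat.cast_sub (Nat.div_le_div_right (by gcongr; omega))]
  unfold fastenerFract
  push_cast
  ring

theorem fastenerFract_cyclic {k α β : ℕ} (hβ : 0 < β) [NeZero (2 * β * k)]
    (ω : Fin (2 * β * k)) :
    fastenerFract k α β (ω + 1 : Fin (2 * β * k)).val = fastenerFract k α β (ω.val + 1) := by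
  rw [Fin.val_add_one_mod]
  rcases Nat.lt_or_ge (ω.val + 1) (2 * β * k) with h | h
  · rw [Nat.mod_eq_of_lt h]
  · have : ω.val + 1 = 2 * β * k := by have := ω.2; omega
    rw [this, Nat.mod_self, fastenerFract_period hβ]
    simp [fastenerFract]

theorem card_fastenerNodes_filter (m k : ℕ) (a : ℚ) (P : Fin m × Fin k → Prop)
    [DecidablePred P] :
    ((fastenerNodes m k a).filter P).card =
      ∑ ω : Fin m, (Finset.univ.filter fun t : Fin k =>
        t.val < fastenerCount k a ω ∧ P (ω, t)).card := by
  unfold fastenerNodes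
  rw [Finset.filter_filter]
  simp_rw [Finset.card_filter]
  rw [Fintype.sum_prod_type]

theorem card_fin_filter_lt {k s : ℕ} (h : s ≤ k) :
    (Finset.univ.filter fun t : Fin k => t.val < s).card = s := by
  rw [Fin.card_filter_val_lt, min_eq_right h]

theorem card_fastenerNodes {k α β : ℕ} (hβ : 0 < β) (h : α ≤ β) :
    (fastenerNodes (2 * β * k) k ((α : ℚ) / β)).card = 2 * α * k * k := by
  have h1 := card_fastenerNodes_filter (2 * β * k) k ((α : ℚ) / β) fun _ => True
  simp only [Finset.filter_true, and_true] at h1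
  rw [h1]
  simp_rw [card_fin_filter_lt (fastenerCount_le hβ h _)]
  rw [sum_fastenerCount, show α * (2 * β * k) * k = β * (2 * α * k * k) by ring,
    Nat.mul_div_cancel_left _ hβ]

/-- The two lexicographically first fastener nodes have ranks 0 and 1. This attaches both roots to
the cycle, as connectivity requires. -/
theorem exists_fastenerRank {m k : ℕ} {a : ℚ} (h : 2 ≤ (fastenerNodes m k a).card) (b : Fin 2) :
    ∃ v ∈ fastenerNodes m k a, fastenerRank m k a v % 2 = b.val := by
  classical
  set N := fastenerNodes m k a with hN
  have hlt : ∀ v w : Fin m × Fin k, (w.1 < v.1 ∨ (w.1 = v.1 ∧ w.2 < v.2)) ↔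
      toLex w < toLex v := fun v w => Prod.Lex.toLex_lt_toLex.symm
  obtain ⟨x, hx, hxmin⟩ := N.exists_min_image (fun v => toLex v)
    (Finset.card_pos.1 (by omega))
  obtain ⟨y, hy, hymin⟩ := (N.erase x).exists_min_image (fun v => toLex v)
    (Finset.card_pos.1 (by rw [Finset.card_erase_of_mem hx]; omega))
  have hy' := Finset.mem_erase.1 hy
  have hrank : ∀ v, fastenerRank m k a v = (N.filter fun w => toLex w < toLex v).card := by
    intro v
    unfold fastenerRank
    congr 1
    refine Finset.filter_congr fun w _ => hlt v w
  have hx0 : fastenerRank m k a x = 0 := by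
    rw [hrank, Finset.card_eq_zero, Finset.filter_eq_empty_iff]
    exact fun w hw => not_lt.2 (hxmin w hw)
  have hy1 : fastenerRank m k a y = 1 := by
    rw [hrank, Finset.card_eq_one]
    refine ⟨x, ?_⟩
    ext w
    simp only [Finset.mem_filter, Finset.mem_singleton]
    constructor
    · rintro ⟨hw, hwy⟩
      by_contra hne
      exact not_lt.2 (hymin w (Finset.mem_erase.2 ⟨hne, hw⟩)) hwy
    · rintro rfl
      exact ⟨hx, lt_of_le_of_ne (hxmin y hy'.2) fun h => hy'.1 (toLex.injective h).symm⟩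
  fin_cases b
  · exact ⟨x, hx, by rw [hx0]⟩
  · exact ⟨y, hy'.2, by rw [hy1]⟩

end Fasteners

/-! ### Edge set of the motif and crossing edges -/

section Edges

variable {m k : ℕ} {a : ℚ}

/-- The edge at a fastener node. -/
def fastenerEdge (a : ℚ) (v : Fin m × Fin k) : Sym2 (MotifVertex m k) :=
  s(Sum.inl ⟨fastenerRank m k a v % 2, Nat.mod_lt _ two_pos⟩, Sum.inr v)

theorem blowUpMotif_adj_inl_inr {b : Fin 2} {v : Fin m × Fin k} :
    (blowUpMotif m k a).Adj (Sum.inl b) (Sum.inr v) ↔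
      v ∈ fastenerNodes m k a ∧ fastenerRank m k a v % 2 = b.val := by
  unfold blowUpMotif
  rw [SimpleGraph.fromRel_adj]
  simp [blowUpRel]

theorem blowUpMotif_not_adj_inl {b b' : Fin 2} :
    ¬ (blowUpMotif m k a).Adj (Sum.inl b) (Sum.inl b') := by
  unfold blowUpMotif
  rw [SimpleGraph.fromRel_adj]
  simp [blowUpRel]

theorem fastenerEdge_injective :
    Function.Injective (fastenerEdge a : Fin m × Fin k → Sym2 (MotifVertex m k)) := by
  intro v v' h
  simp only [fastenerEdge, Sym2.eq_iff] at h
  rcases h with ⟨-, h⟩ | ⟨h, -⟩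
  · exact Sum.inr_injective h
  · cases h

/-- The number of nodes of label `l` in the layer `ω`. -/
def layerCount (c : MotifVertex m k → ℕ) (l : ℕ) (ω : Fin m) : ℕ :=
  (Finset.univ.filter fun t : Fin k => c (Sum.inr (ω, t)) = l).card

theorem layerCount_le (c : MotifVertex m k → ℕ) (l : ℕ) (ω : Fin m) :
    layerCount c l ω ≤ k :=
  (Finset.card_filter_le _ _).trans (by simp)

theorem sum_layerCount (c : MotifVertex m k → ℕ) (S : Finset ℕ) (hS : ∀ x, c x ∈ S)
    (ω : Fin m) : ∑ l ∈ S, layerCount c l ω = k := by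
  have h := Finset.card_eq_sum_card_fiberwise (s := (Finset.univ : Finset (Fin k))) (t := S)
    (f := fun t => c (Sum.inr (ω, t))) fun t _ => hS _
  rw [Finset.card_univ, Fintype.card_fin] at h
  exact h.symm

variable [NeZero m]

/-- The cycle edge from the node `x.1` to the node at position `x.2` of the next layer. -/
def cycleEdge (x : (Fin m × Fin k) × Fin k) : Sym2 (MotifVertex m k) :=
  s(Sum.inr x.1, Sum.inr (x.1.1 + 1, x.2))

theorem blowUpMotif_adj_inr {u v : Fin m × Fin k} (hm : 2 ≤ m) :
    (blowUpMotif m k a).Adj (Sum.inr u) (Sum.inr v) ↔ v.1 = u.1 + 1 ∨ u.1 = v.1 + 1 := by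
  have key : ∀ u v : Fin m × Fin k, (u.1.val + 1) % m = v.1.val ↔ v.1 = u.1 + 1 := by
    intro u v
    rw [← Fin.val_add_one_mod, Fin.ext_iff]
    exact eq_comm
  unfold blowUpMotif
  rw [SimpleGraph.fromRel_adj]
  simp only [blowUpRel, key, and_iff_right_iff_imp]
  intro h heq
  have huv : u = v := Sum.inr_injective heq
  subst huv
  have h1 : u.1 = u.1 + 1 := by tauto
  have h2 := congrArg Fin.val h1
  rw [Fin.val_add_one_mod] at h2
  have := u.1.2
  rcases Nat.lt_or_ge (u.1.val + 1) m with h3 | h3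
  · rw [Nat.mod_eq_of_lt h3] at h2; omega
  · have h4 : u.1.val + 1 = m := by omega
    rw [h4, Nat.mod_self] at h2; omega

/-- With at least three layers, two layers cannot be successors of each other, so an edge determines
its direction. -/
theorem cycleEdge_injective (hm : 3 ≤ m) :
    Function.Injective (cycleEdge : (Fin m × Fin k) × Fin k → Sym2 (MotifVertex m k)) := by
  rintro ⟨u, t⟩ ⟨u', t'⟩ h
  simp only [cycleEdge, Sym2.eq_iff, Sum.inr.injEq, Prod.mk.injEq] at h
  rcases h with ⟨h1, -, h2⟩ | ⟨h1, h2⟩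
  · rw [h1, h2]
  · exfalso
    have h3 : u.1 = u'.1 + 1 := by rw [h1]
    have h4 : u'.1 = u.1 + 1 := by rw [← h2]
    have h5 := congrArg Fin.val h3
    have h6 := congrArg Fin.val h4
    rw [Fin.val_add_one_mod] at h5 h6
    have := u.1.2
    have := u'.1.2
    rcases Nat.lt_or_ge (u.1.val + 1) m with h7 | h7 <;>
      rcases Nat.lt_or_ge (u'.1.val + 1) m with h8 | h8
    · rw [Nat.mod_eq_of_lt h8] at h5; rw [Nat.mod_eq_of_lt h7] at h6; omega
    · rw [show u'.1.val + 1 = m by omega, Nat.mod_self] at h5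
      rw [Nat.mod_eq_of_lt h7] at h6; omega
    · rw [show u.1.val + 1 = m by omega, Nat.mod_self] at h6
      rw [Nat.mod_eq_of_lt h8] at h5; omega
    · rw [show u'.1.val + 1 = m by omega, Nat.mod_self] at h5
      rw [show u.1.val + 1 = m by omega, Nat.mod_self] at h6; omega

open Classical in
theorem blowUpMotif_edgeFinset (hm : 3 ≤ m) [Fintype (blowUpMotif m k a).edgeSet] :
    (blowUpMotif m k a).edgeFinset =
      Finset.univ.image cycleEdge ∪ (fastenerNodes m k a).image (fastenerEdge a) := by
  ext e
  rw [SimpleGraph.mem_edgeFinset, Finset.mem_union, Finset.mem_image, Finset.mem_image]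
  have hfas : ∀ (b : Fin 2) (v : Fin m × Fin k),
      ((v ∈ fastenerNodes m k a ∧ fastenerRank m k a v % 2 = b.val) ↔
        ∃ w ∈ fastenerNodes m k a, fastenerEdge a w = s(Sum.inl b, Sum.inr v)) := by
    intro b v
    constructor
    · rintro ⟨h1, h2⟩
      refine ⟨v, h1, ?_⟩
      simp [fastenerEdge, h2]
    · rintro ⟨w, hw, h⟩
      simp only [fastenerEdge, Sym2.eq_iff] at h
      rcases h with ⟨h1, h2⟩ | ⟨h, -⟩
      · cases Sum.inr_injective h2
        exact ⟨hw, congrArg Fin.val (Sum.inl_injective h1)⟩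
      · cases h
  have hcyc : ∀ (b : Fin 2) (x : MotifVertex m k) (y : (Fin m × Fin k) × Fin k),
      cycleEdge y ≠ s(Sum.inl b, x) := by
    intro b x y h
    simp only [cycleEdge, Sym2.eq_iff] at h
    rcases h with ⟨h, -⟩ | ⟨-, h⟩ <;> cases h
  induction e using Sym2.ind with
  | h x y =>
    rw [SimpleGraph.mem_edgeSet]
    rcases x with b | u <;> rcases y with b' | v
    · refine iff_of_false blowUpMotif_not_adj_inl ?_
      rintro (⟨y, -, h⟩ | ⟨w, -, h⟩)
      · exact hcyc _ _ _ h
      · simp only [fastenerEdge, Sym2.eq_iff] at h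
        rcases h with ⟨-, h⟩ | ⟨-, h⟩ <;> cases h
    · rw [blowUpMotif_adj_inl_inr, hfas]
      constructor
      · exact Or.inr
      · rintro (⟨y, -, h⟩ | h)
        · exact absurd h (hcyc _ _ _)
        · exact h
    · rw [SimpleGraph.adj_comm, blowUpMotif_adj_inl_inr, hfas, Sym2.eq_swap]
      constructor
      · exact Or.inr
      · rintro (⟨y, -, h⟩ | h)
        · exact absurd (h.trans Sym2.eq_swap) (hcyc _ _ _)
        · exact h
    · rw [blowUpMotif_adj_inr (by omega)]
      constructor
      · rintro (h | h)
        · refine Or.inl ⟨(u, v.2), Finset.mem_univ _, ?_⟩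
          simp only [cycleEdge]
          rw [← h]
        · refine Or.inl ⟨(v, u.2), Finset.mem_univ _, ?_⟩
          simp only [cycleEdge]
          rw [← h]
          exact Sym2.eq_swap
      · rintro (⟨y, -, h⟩ | ⟨w, -, h⟩)
        · simp only [cycleEdge, Sym2.eq_iff, Sum.inr.injEq] at h
          rcases h with ⟨h1, h2⟩ | ⟨h1, h2⟩
          · left; rw [← h1, ← h2]
          · right; rw [← h1, ← h2]
        · simp only [fastenerEdge, Sym2.eq_iff] at h
          rcases h with ⟨h, -⟩ | ⟨h, -⟩ <;> cases h

theorem card_blowUpMotif_edges_filter (hm : 3 ≤ m) [Fintype (blowUpMotif m k a).edgeSet]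
    (P : Sym2 (MotifVertex m k) → Prop) [DecidablePred P] :
    ((blowUpMotif m k a).edgeFinset.filter P).card =
      (Finset.univ.filter fun x : (Fin m × Fin k) × Fin k => P (cycleEdge x)).card +
        ((fastenerNodes m k a).filter fun v => P (fastenerEdge a v)).card := by
  classical
  rw [blowUpMotif_edgeFinset hm, Finset.filter_union, Finset.card_union_of_disjoint,
    Finset.filter_image, Finset.filter_image,
    Finset.card_image_of_injective _ (cycleEdge_injective hm),
    Finset.card_image_of_injective _ fastenerEdge_injective]
  rw [Finset.disjoint_left]
  intro e he he'
  obtain ⟨x, -, rfl⟩ := Finset.mem_image.1 (Finset.mem_filter.1 he).1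
  obtain ⟨v, -, h⟩ := Finset.mem_image.1 (Finset.mem_filter.1 he').1
  simp only [fastenerEdge, cycleEdge, Sym2.eq_iff] at h
  rcases h with ⟨h, -⟩ | ⟨h, -⟩ <;> cases h

/-- Each crossing edge is charged once, to the label of its tail: a tail labelled l in layer ω has k
- t(ω+1) heads with other labels, where t counts the nodes labelled l. -/
theorem card_cycleEdge_crossing (c : MotifVertex m k → ℕ) (S : Finset ℕ) (hS : ∀ x, c x ∈ S) :
    ((Finset.univ.filter fun x : (Fin m × Fin k) × Fin k =>
      c (Sum.inr x.1) ≠ c (Sum.inr (x.1.1 + 1, x.2))).card : ℝ) =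
      ∑ l ∈ S, halfBoundary k (layerCount c l) := by
  have h1 : ∀ ω t, (((Finset.univ.filter fun t' : Fin k =>
      c (Sum.inr (ω, t)) ≠ c (Sum.inr (ω + 1, t'))).card : ℕ) : ℝ) =
      k - layerCount c (c (Sum.inr (ω, t))) (ω + 1) := by
    intro ω t
    have h := Finset.card_filter_add_card_filter_not (s := (Finset.univ : Finset (Fin k)))
      fun t' => c (Sum.inr (ω + 1, t')) = c (Sum.inr (ω, t))
    rw [Finset.card_univ, Fintype.card_fin] at h
    have h' : ((layerCount c (c (Sum.inr (ω, t))) (ω + 1) : ℕ) : ℝ) +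
        (Finset.univ.filter fun t' : Fin k =>
          c (Sum.inr (ω, t)) ≠ c (Sum.inr (ω + 1, t'))).card = k := by
      simp_rw [ne_comm (a := c (Sum.inr (ω, t)))]
      exact_mod_cast h
    linarith
  rw [Finset.card_filter, Fintype.sum_prod_type, Fintype.sum_prod_type]
  simp_rw [← Finset.card_filter]
  push_cast
  simp_rw [h1]
  unfold halfBoundary
  rw [Finset.sum_comm (s := S)]
  refine Finset.sum_congr rfl fun ω _ => ?_
  rw [← Finset.sum_fiberwise_of_maps_to (s := Finset.univ) (t := S)
    (g := fun t => c (Sum.inr (ω, t))) fun t _ => hS _]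
  refine Finset.sum_congr rfl fun l _ => ?_
  rw [Finset.sum_congr rfl fun t ht => by rw [(Finset.mem_filter.1 ht).2], Finset.sum_const,
    nsmul_eq_mul]
  rfl

/-- As many forward edges enter a set as leave it, since every node has k incoming and k outgoing
cycle edges. -/
theorem halfBoundary_compl {w t : Fin m → ℕ} (h : ∀ ω, t ω + w ω = k) :
    halfBoundary k t = halfBoundary k w := by
  have h' : ∀ ω, (t ω : ℝ) = k - w ω := fun ω => by
    have : (t ω : ℝ) + w ω = k := by exact_mod_cast h ω
    linarith
  have hs := sum_cyclic_shift fun ω => (w ω : ℝ)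
  unfold halfBoundary
  have h1 : ∀ ω, (t ω : ℝ) * (k - t (ω + 1)) =
      (w ω : ℝ) * (k - w (ω + 1)) + k * w (ω + 1) - k * w ω := by
    intro ω
    rw [h' ω, h' (ω + 1)]; ring
  simp_rw [h1, Finset.sum_sub_distrib, Finset.sum_add_distrib, ← Finset.mul_sum]
  rw [hs]
  ring

end Edges

/-! ### Balancedness of the blow-up graph with fasteners -/

section Balanced

variable {k α β : ℕ}

theorem layerCount_add_compl {m k : ℕ} (c : MotifVertex m k → ℕ) (l : ℕ) (ω : Fin m) :
    layerCount c l ω +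
      (Finset.univ.filter fun t : Fin k => c (Sum.inr (ω, t)) ≠ l).card = k := by
  have h := Finset.card_filter_add_card_filter_not (s := (Finset.univ : Finset (Fin k)))
    fun t => c (Sum.inr (ω, t)) = l
  rw [Finset.card_univ, Fintype.card_fin] at h
  exact h

/-- A set of `t ω` nodes in the layer `ω`, not all zero. -/
theorem add_le_halfBoundary_add [NeZero (2 * β * k)] (hk : 0 < k) (hα : 0 < α) (hαβ : α < β)
    {t : Fin (2 * β * k) → ℕ} (htk : ∀ ω, t ω ≤ k) {ω₀ : Fin (2 * β * k)} (h₀ : t ω₀ ≠ 0) :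
    (k : ℝ) + (α : ℝ) / β ≤ halfBoundary k t + (α : ℝ) / β * ∑ ω, (t ω : ℝ) := by
  have hβ : 0 < β := hα.trans hαβ
  have hβ' : (0 : ℝ) < β := by exact_mod_cast hβ
  have hk1 : (1 : ℝ) ≤ k := by exact_mod_cast hk
  have hα1 : (1 : ℝ) ≤ α := by exact_mod_cast hα
  -- If all layers are full, the boundary vanishes but the weight a·mk = 2αk² is at least k + a.
  -- Otherwise the boundary gives k and a single node gives a.
  by_cases hall : ∀ ω, t ω = k
  · have h1 : halfBoundary k t = 0 := by simp [halfBoundary, hall]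
    have h2 : (α : ℝ) / β * ∑ ω, (t ω : ℝ) = 2 * α * k * k := by
      simp only [hall, Finset.sum_const, Finset.card_univ, Fintype.card_fin, nsmul_eq_mul]
      push_cast
      field_simp
    have h3 : (α : ℝ) / β ≤ 1 := (div_le_one hβ').2 (by exact_mod_cast hαβ.le)
    have h4 : (k : ℝ) ≤ k * k := by nlinarith
    have h5 : (k : ℝ) * k ≤ α * (k * k) := by nlinarith
    rw [h1, h2]
    linarith
  · push Not at hall
    obtain ⟨ω₁, h₁⟩ := hall
    have h1 := le_halfBoundary (by nlinarith) htk h₀ h₁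
    have h2 : (1 : ℝ) ≤ ∑ ω, (t ω : ℝ) := by
      have h3 : (1 : ℝ) ≤ t ω₀ := by exact_mod_cast Nat.one_le_iff_ne_zero.2 h₀
      exact h3.trans (Finset.single_le_sum (f := fun ω => (t ω : ℝ))
        (fun ω _ => Nat.cast_nonneg _) (Finset.mem_univ ω₀))
    have h3 : 0 ≤ (α : ℝ) / β := by positivity
    nlinarith

theorem connected_blowUpMotif {m k : ℕ} [NeZero m] {a : ℚ} (hm : 2 ≤ m) (hk : 0 < k)
    (h : 2 ≤ (fastenerNodes m k a).card) : (blowUpMotif m k a).Connected := by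
  let x : MotifVertex m k := Sum.inr (0, ⟨0, hk⟩)
  have hstep : ∀ ω (t t' : Fin k),
      (blowUpMotif m k a).Adj (Sum.inr (ω, t)) (Sum.inr (ω + 1, t')) := fun ω t t' =>
    (blowUpMotif_adj_inr hm).2 (Or.inl rfl)
  have hreach : ∀ ω, ∀ t : Fin k, (blowUpMotif m k a).Reachable x (Sum.inr (ω, t)) :=
    Fin.forall_of_cyclic (ω₀ := 0 + 1)
      (fun ω hω t => (hω ⟨0, hk⟩).trans (hstep ω _ t).reachable)
      fun t => (hstep 0 ⟨0, hk⟩ t).reachable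
  have hall : ∀ y, (blowUpMotif m k a).Reachable x y := by
    rintro (b | ⟨ω, t⟩)
    · obtain ⟨v, hv, hb⟩ := exists_fastenerRank h b
      exact (hreach v.1 v.2).trans (blowUpMotif_adj_inl_inr.2 ⟨hv, hb⟩).symm.reachable
    · exact hreach ω t
  exact SimpleGraph.connected_iff_exists_forall_reachable _ |>.2 ⟨x, hall⟩

theorem isBalancedMotif_blowUpMotif (hk : 0 < k) (hα : 0 < α) (hαβ : α < β) :
    IsBalancedMotif (blowUpMotif (2 * β * k) k ((α : ℚ) / β))
      (MotifVertex.v₁ (2 * β * k) k) (MotifVertex.v₂ (2 * β * k) k) ((k : ℝ) + (α : ℝ) / β) := by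
  classical
  have hβ : 0 < β := hα.trans hαβ
  have hβ' : (0 : ℝ) < β := by exact_mod_cast hβ
  have hm : 3 ≤ 2 * β * k := by
    have : 2 ≤ β := by omega
    nlinarith
  have : NeZero (2 * β * k) := ⟨by omega⟩
  have hcardN := card_fastenerNodes (k := k) hβ hαβ.le
  refine ⟨connected_blowUpMotif (by omega) hk ?_, blowUpMotif_not_adj_inl, ?_, ?_⟩
  · rw [hcardN]
    have : 0 < α * k * k := by positivity
    nlinarith
  · have h := card_blowUpMotif_edges_filter (a := (α : ℚ) / β) (k := k) hm fun _ => True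
    simp only [Finset.filter_true, Finset.card_univ] at h
    have hcyc : Fintype.card ((Fin (2 * β * k) × Fin k) × Fin k) = 2 * β * k * k * k := by simp
    have hV : Fintype.card (MotifVertex (2 * β * k) k) = 2 + 2 * β * k * k := by
      simp [MotifVertex]
    rw [hcardN, hcyc] at h
    have h' : ((blowUpMotif (2 * β * k) k ((α : ℚ) / β)).edgeFinset.card : ℝ) =
        2 * β * k * k * k + 2 * α * k * k := by exact_mod_cast h
    rw [h', hV]
    push_cast
    field_simp
    ring
  · intro c hc
    set S := Finset.univ.image c with hS
    set l₀ := c (MotifVertex.v₁ (2 * β * k) k) with hl₀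
    have hcS : ∀ x, c x ∈ S := fun x => Finset.mem_image_of_mem c (Finset.mem_univ x)
    rw [card_blowUpMotif_edges_filter hm]
    let w : Fin (2 * β * k) → ℕ := fun ω =>
      (Finset.univ.filter fun t : Fin k => c (Sum.inr (ω, t)) ≠ l₀).card
    let f : Fin (2 * β * k) → ℕ := fun ω => (Finset.univ.filter fun t : Fin k =>
      t.val < fastenerCount k ((α : ℚ) / β) ω ∧ c (Sum.inr (ω, t)) ≠ l₀).card
    have hcyc := card_cycleEdge_crossing c S hcS
    have hfas : ((fastenerNodes (2 * β * k) k ((α : ℚ) / β)).filter fun v =>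
        ¬ ((fastenerEdge ((α : ℚ) / β) v).map c).IsDiag).card = ∑ ω, f ω := by
      have h := card_fastenerNodes_filter (2 * β * k) k ((α : ℚ) / β)
        fun v => c (Sum.inr v) ≠ l₀
      rw [← h]
      congr 1
      refine Finset.filter_congr fun v _ => ?_
      have hinl : ∀ b : Fin 2, c (Sum.inl b) = l₀ := by
        intro b
        fin_cases b
        · rfl
        · exact hc.symm
      simp only [fastenerEdge, Sym2.map_mk, Sym2.mk_isDiag_iff, hinl]
      exact ne_comm
    have hcyc' : (Finset.univ.filter fun x : (Fin (2 * β * k) × Fin k) × Fin k =>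
        ¬ ((cycleEdge x).map c).IsDiag).card = (Finset.univ.filter
          fun x : (Fin (2 * β * k) × Fin k) × Fin k =>
            c (Sum.inr x.1) ≠ c (Sum.inr (x.1.1 + 1, x.2))).card := by
      congr 1
      refine Finset.filter_congr fun x _ => ?_
      simp [cycleEdge]
    have hwA : (α : ℝ) / β * ∑ ω, (w ω : ℝ) ≤ halfBoundary k w + ∑ ω, (f ω : ℝ) := by
      refine mul_sum_le_halfBoundary_add
        ((div_le_one hβ').2 (by exact_mod_cast hαβ.le))
        (fun ω => (Finset.card_filter_le _ _).trans (by simp))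
        (s := fun ω => (fastenerCount k ((α : ℚ) / β) ω : ℝ))
        (φ := fun ω => fastenerFract k α β ω) (fun ω => fastenerFract_nonneg _ _ _ _)
        (fun ω => fastenerFract_le_one hβ _ _ _) (fun ω => ?_) (fun ω => Nat.cast_nonneg _)
        fun ω => ?_
      · rw [fastenerFract_cyclic hβ, fastenerCount_eq_fract]
      -- Inclusion-exclusion among the k nodes of a layer: its fastener nodes and its nodes outside
      -- the root part must intersect.
      · have h1 := card_fin_filter_lt (fastenerCount_le (k := k) hβ hαβ.le ω.val)
        have h2 := Finset.card_union_add_card_inter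
          (Finset.univ.filter fun t : Fin k => t.val < fastenerCount k ((α : ℚ) / β) ω)
          (Finset.univ.filter fun t : Fin k => c (Sum.inr (ω, t)) ≠ l₀)
        rw [← Finset.filter_and, h1] at h2
        have h3 := Finset.card_le_univ
          ((Finset.univ.filter fun t : Fin k => t.val < fastenerCount k ((α : ℚ) / β) ω) ∪
            Finset.univ.filter fun t : Fin k => c (Sum.inr (ω, t)) ≠ l₀)
        rw [Fintype.card_fin] at h3
        have h4 : fastenerCount k ((α : ℚ) / β) ω + w ω ≤ f ω + k := by
          simp only [w, f]; omega
        have h5 : (fastenerCount k ((α : ℚ) / β) ω : ℝ) + w ω ≤ f ω + k := by exact_mod_cast h4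
        linarith
    have hl₀S : l₀ ∈ S := hcS _
    have hsumw : ∑ ω, (w ω : ℝ) = ∑ l ∈ S.erase l₀, ∑ ω, (layerCount c l ω : ℝ) := by
      rw [Finset.sum_comm]
      refine Finset.sum_congr rfl fun ω _ => ?_
      have h1 := sum_layerCount c S hcS ω
      rw [← Finset.add_sum_erase _ _ hl₀S] at h1
      have h2 := layerCount_add_compl c l₀ ω
      have h3 : w ω = ∑ l ∈ S.erase l₀, layerCount c l ω := by
        simp only [w]; omega
      exact_mod_cast h3
    have hl₀b : halfBoundary k (layerCount c l₀) = halfBoundary k w :=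
      halfBoundary_compl fun ω => layerCount_add_compl c l₀ ω
    have hparts : ∑ _l ∈ S.erase l₀, ((k : ℝ) + (α : ℝ) / β) ≤
        ∑ l ∈ S.erase l₀, (halfBoundary k (layerCount c l) +
          (α : ℝ) / β * ∑ ω, (layerCount c l ω : ℝ)) := by
      refine Finset.sum_le_sum fun l hl => ?_
      obtain ⟨hne, hlS⟩ := Finset.mem_erase.1 hl
      obtain ⟨x, -, hx⟩ := Finset.mem_image.1 hlS
      rcases x with b | ⟨ω, t⟩
      · exfalso
        apply hne
        rw [← hx]
        fin_cases b
        · rfl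
        · exact hc.symm
      · refine add_le_halfBoundary_add hk hα hαβ (layerCount_le c l) (ω₀ := ω) ?_
        exact (Finset.card_pos.2 ⟨t, Finset.mem_filter.2 ⟨Finset.mem_univ _, hx⟩⟩).ne'
    rw [Finset.sum_const, nsmul_eq_mul, Finset.card_erase_of_mem hl₀S,
      Nat.cast_sub (Finset.card_pos.2 ⟨l₀, hl₀S⟩), Finset.sum_add_distrib, ← Finset.mul_sum,
      ← hsumw] at hparts
    -- The root part and its complement have the same forward boundary, so the one term not used in
    -- `hparts` is exactly what `hwA` needs.
    rw [← Finset.add_sum_erase _ _ hl₀S, hl₀b] at hcyc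
    have hfas' : (((fastenerNodes (2 * β * k) k ((α : ℚ) / β)).filter fun v =>
        ¬ ((fastenerEdge ((α : ℚ) / β) v).map c).IsDiag).card : ℝ) = ∑ ω, (f ω : ℝ) := by
      exact_mod_cast hfas
    push_cast at hparts ⊢
    rw [hcyc', hcyc, hfas']
    linarith

end Balanced

/-! ### Union bound over pairs and the main theorem -/

section Main

open Classical

instance {n K : ℕ} [NeZero K] (p q : ℝ) : IsProbabilityMeasure (sbm n K p q) := by
  unfold sbm; infer_instance

theorem countThreshold_eq {n K m k : ℕ} {a : ℚ} {lam r : ℝ} (hr : r = (k : ℝ) + (a : ℝ))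
    (h : m * k ≤ blockSize n) :
    countThreshold n K m k a lam =
      ((blockSize n).descFactorial (m * k) * (lam ^ r / K) ^ (m * k) : ℝ) / 2 := by
  unfold countThreshold
  rw [← hr, ← Nat.factorial_mul_descFactorial h]
  have : ((blockSize n - m * k).factorial : ℝ) ≠ 0 := by positivity
  push_cast
  field_simp

theorem one_sub_le_sbm_real_recovers {n K m k : ℕ} [NeZero K] {a : ℚ} {p q r : ℝ}
    (hr : r = (k : ℝ) + (a : ℝ)) (hmk : m * k ≤ blockSize n) (hn : 0 < n)
    (J : Fin n → Fin n → Fin (numBlocks n) → Finset (Fin n))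
    (med : (Fin (numBlocks n) → ℝ) → ℝ) (hmed : ∀ u, IsMedian u (med u))
    (hbad : ∀ i j : Fin n, i < j → (sbm n K p q).real {ω | numBlocks n ≤
      2 * (Finset.univ.filter fun l =>
        ((blockSize n).descFactorial (m * k) * ((p - q) ^ r / K) ^ (m * k) : ℝ) / 2 ≤
          |motifCount (blowUpMotif m k a) (MotifVertex.v₁ m k) (MotifVertex.v₂ m k) q ω.2 i j
            (J i j l) - if ω.1 i = ω.1 j then
              ((blockSize n).descFactorial (m * k) * ((p - q) ^ r / K) ^ (m * k) : ℝ)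
                else 0|).card} ≤ 1 / (n : ℝ) ^ 3) :
    1 - 1 / (n : ℝ) ≤ (sbm n K p q).real {ω : SBMSample n K |
      Recovers (fun i j => blowUpEstimator K m k a (p - q) q med (J i j) ω.2 i j) ω.1} := by
  set T : ℝ := (blockSize n).descFactorial (m * k) * ((p - q) ^ r / K) ^ (m * k) with hT
  set bad : Fin n × Fin n → Set (SBMSample n K) := fun x => {ω | numBlocks n ≤
      2 * (Finset.univ.filter fun l => T / 2 ≤
          |motifCount (blowUpMotif m k a) (MotifVertex.v₁ m k) (MotifVertex.v₂ m k) q ω.2 x.1 x.2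
            (J x.1 x.2 l) - if ω.1 x.1 = ω.1 x.2 then T else 0|).card} with hbaddef
  set good := {ω : SBMSample n K |
      Recovers (fun i j => blowUpEstimator K m k a (p - q) q med (J i j) ω.2 i j) ω.1} with hgood
  let P : Finset (Fin n × Fin n) := Finset.univ.filter fun x => x.1 < x.2
  have hsub : goodᶜ ⊆ ⋃ x ∈ P, bad x := by
    intro ω hω
    by_contra hcon
    apply hω
    simp only [Set.mem_iUnion, not_exists] at hcon
    refine recovers_of_forall_lt fun i j hij => ?_
    have h1 : ω ∉ bad (i, j) := hcon (i, j) (Finset.mem_filter.2 ⟨Finset.mem_univ _, hij⟩)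
    have h2 := (hmed fun l => motifCount (blowUpMotif m k a) (MotifVertex.v₁ m k)
      (MotifVertex.v₂ m k) q ω.2 i j (J i j l)).lt_iff_of_not_majority_bad
        (ω.1 i = ω.1 j) (T := T) h1
    unfold blowUpEstimator membership
    rw [countThreshold_eq hr hmk, ← hT]
    congr 1
    by_cases hz : ω.1 i = ω.1 j
    · rw [if_pos hz, if_pos (h2.2 hz)]
    · rw [if_neg hz, if_neg fun h => hz (h2.1 h)]
  have hn0 : (0 : ℝ) < n := by exact_mod_cast hn
  have hP : (P.card : ℝ) ≤ (n : ℝ) ^ 2 := by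
    have : P.card ≤ n ^ 2 := by
      refine (Finset.card_le_univ P).trans ?_
      rw [Fintype.card_prod, Fintype.card_fin, sq]
    exact_mod_cast this
  have hle : (sbm n K p q).real goodᶜ ≤ 1 / n := by
    calc (sbm n K p q).real goodᶜ ≤ (sbm n K p q).real (⋃ x ∈ P, bad x) :=
          measureReal_mono hsub (measure_ne_top _ _)
      _ ≤ ∑ x ∈ P, (sbm n K p q).real (bad x) := measureReal_biUnion_finset_le _ _
      _ ≤ ∑ _x ∈ P, 1 / (n : ℝ) ^ 3 :=
          Finset.sum_le_sum fun x hx => hbad x.1 x.2 (Finset.mem_filter.1 hx).2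
      _ = P.card * (1 / (n : ℝ) ^ 3) := by rw [Finset.sum_const, nsmul_eq_mul]
      _ ≤ (n : ℝ) ^ 2 * (1 / (n : ℝ) ^ 3) := by gcongr
      _ = 1 / n := by field_simp
  rw [probReal_compl_eq_one_sub (Set.toFinite _).measurableSet] at hle
  linarith

end Main

theorem mainTheorem4 :
    ∃ c₀ : ℝ, 0 < c₀ ∧
      ∀ k α β : ℕ, 0 < k → 0 < α → α < β →
        -- the motif has the required structure, with `r = k + α / β`, `m = 2 β k`, `a = α / β`
        IsBalancedMotif (blowUpMotif (2 * β * k) k ((α : ℚ) / β))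
          (MotifVertex.v₁ (2 * β * k) k) (MotifVertex.v₂ (2 * β * k) k)
          ((k : ℝ) + (α : ℝ) / β) ∧
        -- counting it recovers the communities
        ∃ w : ℝ, 0 < w ∧
          ∀ (n K : ℕ) (p q r lam : ℝ), 2 ≤ K → K ≤ n → 0 < q → q < p → p < 1 →
            r = (k : ℝ) + (α : ℝ) / β →
            lam = p - q →
            q * (1 - q) = (n : ℝ) ^ (-1 / r) →
            c₀ * β * (k : ℝ) ^ 2 * Real.log n ≤ n →
            lam ≤ 1 - 2 * q →
            w * Real.log n ^ (1 / r) *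
                (lam / K + q * (1 - q)) ^ (1 - Real.logb n K) ≤ lam →
            ∀ J : Fin n → Fin n → Fin (numBlocks n) → Finset (Fin n),
              (∀ i j, i < j → IsBlockFamily i j (J i j)) →
            ∀ med : (Fin (numBlocks n) → ℝ) → ℝ, (∀ u, IsMedian u (med u)) →
              1 - 1 / (n : ℝ) ≤
                (sbm n K p q).real {ω : SBMSample n K |
                  Recovers (fun i j => blowUpEstimator K (2 * β * k) k ((α : ℚ) / β) lam q
                    med (J i j) ω.2 i j) ω.1} := by
  refine ⟨1, one_pos, fun k α β hk hα hαβ => ?_⟩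
  have hG := isBalancedMotif_blowUpMotif hk hα hαβ
  refine ⟨hG, ?_⟩
  classical
  have hβ : 0 < β := hα.trans hαβ
  have hcard : Fintype.card (MotifVertex (2 * β * k) k) - 2 = 2 * β * k * k := by
    simp [MotifVertex]
  have hD : 0 < 2 * β * k * k := by positivity
  have hr0 : 0 < (k : ℝ) + (α : ℝ) / β := by positivity
  have hv : MotifVertex.v₁ (2 * β * k) k ≠ MotifVertex.v₂ (2 * β * k) k := by
    simp [MotifVertex.v₁, MotifVertex.v₂]
  set W := signalConst (blowUpMotif (2 * β * k) k ((α : ℚ) / β)).edgeFinset.card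
    (2 * β * k * k) with hWdef
  have hW : 0 < W := by
    have := momentConst_pos (blowUpMotif (2 * β * k) k ((α : ℚ) / β)).edgeFinset.card
      (2 * β * k * k)
    rw [hWdef, signalConst]; positivity
  -- The r-th root, because `signal_lower_bound` raises the signal condition to the power r.
  refine ⟨W ^ (1 / ((k : ℝ) + (α : ℝ) / β)), by positivity, ?_⟩
  intro n K p q r lam hK hKn hq hqp hp hr hlam hqb _ hlq hsig J hJ med hmed
  rw [← hr] at hG hsig hr0
  subst hlam
  have : NeZero K := ⟨by omega⟩
  have hlow := signal_lower_bound hr0 hK hKn (by linarith) hqb hW hsig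
  refine one_sub_le_sbm_real_recovers (r := r) (by rw [hr]; push_cast; rfl) ?_ (by omega) J med
    hmed ?_
  · obtain ⟨-, h2, h3⟩ := signalConst_bounds
      (blowUpMotif (2 * β * k) k ((α : ℚ) / β)).edgeFinset.card hD
    have h4 := (le_blockSize_of_signal hK hKn h3
      (Real.rpow_le_one (by linarith) (by linarith) hr0.le) hlow).2
    rw [← hWdef] at h2
    have : ((2 * β * k * k : ℕ) : ℝ) ≤ blockSize n := by
      have h5 : (0 : ℝ) ≤ (2 * β * k * k : ℕ) := Nat.cast_nonneg _
      linarith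
    exact_mod_cast this
  · intro i j hij
    have := hG.sbm_real_bad_pair_le hr0 hv (by rw [hcard]; exact hD) hK hKn hq hqp hp hqb hlq
      (by rw [hcard]; exact hlow) hij.ne (hJ i j hij)
    rw [hcard] at this
    exact this
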